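/- Let $d\ge 1$ and let $\chi\in C_c^\infty(-1,1)$ be a fixed real-valued function with $\chi=1$ on $(-\tfrac12,\tfrac12)$; write $\chi_\infty=1-\chi$. Let $\alpha\in\mathbb{R}\setminus\{0,1\}$ and let $\phi:\mathbb{R}^d\to\mathbb{R}$ be almost homogeneous of order $\alpha$, that is, $\phi\in C^{d+2}(\mathbb{R}^d\setminus\{0\})$ and there are constants $B,\lambda,d_1,d_2>0$ such that for all $\xi\in\mathbb{R}^d\setminus\{0\}$ $$d_1|\xi|^{\alpha-1}\le|\nabla\phi(\xi)|\le d_2|\xi|^{\alpha-1},\qquad |\partial^\gamma\phi(\xi)|\le B|\xi|^{\alpha-|\gamma|}\quad(|\gamma|\le d+2),$$ $$\lambda|\xi|^{\alpha-2}\le |H\phi(\xi)v|\qquad\text{for all } v\in\mathbb{S}^{d-1},$$ where $H\phi=(\partial_i\partial_j\phi)_{i,j}$ is the Hessian matrix (the last condition says that every eigenvalue of $H\phi(\xi)$ has absolute value at least $\lambda|\xi|^{\alpha-2}$). For $\varepsilon>0$, $\kappa\in\mathbb{R}$ and $(x,t)\in\mathbb{R}^d\times\mathbb{R}$ set $$\mathcal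 I^{\phi,+}_{\varepsilon,\kappa}(x,t)=\int_{\mathbb{R}^d}e^{i(x\cdot\xi+t\phi(\xi))}\chi(\varepsilon|\xi|)\,|\det H\phi(\xi)|^{\frac12+i\kappa}\,d\xi\quad\text{if }\alpha>0,$$ $$\mathcal I^{\phi,-}_{\varepsilon,\kappa}(x,t)=\int_{\mathbb{R}^d}e^{i(x\cdot\xi+t\phi(\xi))}\chi_\infty(\varepsilon^{-1}|\xi|)\,|\det H\phi(\xi)|^{\frac12+i\kappa}\,d\xi\quad\text{if }\alpha<0.$$ Then there exist $C<\infty$ and $N>0$ such that, for all $\varepsilon>0$, $\kappa\in\mathbb{R}$ and $(x,t)\in\mathbb{R}^d\times\mathbb{R}$, the integral $\mathcal I^{\phi,\pm}_{\varepsilon,\kappa}(x,t)$ with $\pm\alpha>0$ converges absolutely and, if $t\ne0$, $$|\mathcal I^{\phi,\pm}_{\varepsilon,\kappa}(x,t)|\le C(1+|\kappa|)^N|t|^{-d/2}.$$ -/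

import Mathlib

open MeasureTheory
open scoped ContDiff

/-- The fixed radial profile `χ`: a real-valued function in `C_c^∞(-1,1)` which is equal to `1` on
`(-1/2, 1/2)`. (The closed support lies in the bounded interval `(-1,1)`, so it is compact.) -/
structure IsCutoff (χ : ℝ → ℝ) : Prop where
  smooth : ContDiff ℝ ∞ χ
  tsupport_subset : tsupport χ ⊆ Set.Ioo (-1) 1
  eq_one : ∀ r ∈ Set.Ioo (-(1 / 2) : ℝ) (1 / 2), χ r = 1

/-- The partial derivative `∂_{i₀} ∂_{i₁} ⋯ ∂_{iₙ₋₁} φ (ξ)` of order `n` of a function on `ℝᵈ`. -/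
noncomputable def partialDeriv {d : ℕ} (φ : EuclideanSpace ℝ (Fin d) → ℝ) {n : ℕ}
    (i : Fin n → Fin d) (ξ : EuclideanSpace ℝ (Fin d)) : ℝ :=
  iteratedFDeriv ℝ n φ ξ (fun k => EuclideanSpace.single (i k) (1 : ℝ))

/-- The Hessian matrix `Hφ(ξ) = (∂ᵢ∂ⱼφ(ξ))`. -/
noncomputable def hessianMatrix {d : ℕ} (φ : EuclideanSpace ℝ (Fin d) → ℝ)
    (ξ : EuclideanSpace ℝ (Fin d)) : Matrix (Fin d) (Fin d) ℝ :=
  Matrix.of fun i j => partialDeriv φ ![i, j] ξ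

/-- The class `ℜ(α, B, lam, d₁, d₂)` of phases. The partial derivatives `∂^γ φ` with `|γ| = n` are
listed by the sequences `i` of `n` coordinate directions. The condition `hessian` says that all
eigenvalues of the symmetric matrix `Hφ(ξ)` have absolute value at least `lam * |ξ|^(α-2)`. -/
structure IsAlmostHomogeneousWith {d : ℕ} (α B lam d₁ d₂ : ℝ)
    (φ : EuclideanSpace ℝ (Fin d) → ℝ) : Prop where
  contDiffOn : ContDiffOn ℝ ((d + 2 : ℕ) : ℕ∞) φ {0}ᶜ
  le_norm_gradient : ∀ ξ, ξ ≠ 0 → d₁ * ‖ξ‖ ^ (α - 1) ≤ ‖gradient φ ξ‖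
  norm_gradient_le : ∀ ξ, ξ ≠ 0 → ‖gradient φ ξ‖ ≤ d₂ * ‖ξ‖ ^ (α - 1)
  deriv_le : ∀ ξ, ξ ≠ 0 → ∀ n : ℕ, n ≤ d + 2 → ∀ i : Fin n → Fin d,
    |partialDeriv φ i ξ| ≤ B * ‖ξ‖ ^ (α - (n : ℝ))
  hessian : ∀ ξ, ξ ≠ 0 → ∀ v : EuclideanSpace ℝ (Fin d), ‖v‖ = 1 →
    lam * ‖ξ‖ ^ (α - 2) ≤ ‖Matrix.toEuclideanLin (hessianMatrix φ ξ) v‖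

/-- `φ` is almost homogeneous of order `α`. -/
def IsAlmostHomogeneous {d : ℕ} (α : ℝ) (φ : EuclideanSpace ℝ (Fin d) → ℝ) : Prop :=
  ∃ B lam d₁ d₂ : ℝ, 0 < B ∧ 0 < lam ∧ 0 < d₁ ∧ 0 < d₂ ∧
    IsAlmostHomogeneousWith α B lam d₁ d₂ φ

/-- The damped oscillatory integrand
`e^{i (x·ξ + t φ(ξ))} a(ξ) |det Hφ(ξ)|^{1/2 + iκ}` with cutoff `a`. -/
noncomputable def dampedIntegrand {d : ℕ} (φ a : EuclideanSpace ℝ (Fin d) → ℝ) (κ : ℝ)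
    (x : EuclideanSpace ℝ (Fin d)) (t : ℝ) (ξ : EuclideanSpace ℝ (Fin d)) : ℂ :=
  Complex.exp (Complex.I * ((inner ℝ x ξ + t * φ ξ : ℝ) : ℂ)) * ((a ξ : ℝ) : ℂ) *
    ((|(hessianMatrix φ ξ).det| : ℝ) : ℂ) ^ ((1 / 2 : ℂ) + Complex.I * (κ : ℂ))

/-- The cutoff `χ(ε ξ)`, understood radially as `χ(ε |ξ|)`. -/
noncomputable def cutoffPlus {d : ℕ} (χ : ℝ → ℝ) (ε : ℝ) (ξ : EuclideanSpace ℝ (Fin d)) : ℝ :=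
  χ (ε * ‖ξ‖)

/-- The cutoff `χ_∞(ε⁻¹ ξ)` with `χ_∞ = 1 - χ`, understood radially. -/
noncomputable def cutoffMinus {d : ℕ} (χ : ℝ → ℝ) (ε : ℝ) (ξ : EuclideanSpace ℝ (Fin d)) : ℝ :=
  1 - χ (ε⁻¹ * ‖ξ‖)

/-- The oscillatory integral used for `α > 0`. -/
noncomputable def oscIntegralPlus {d : ℕ} (χ : ℝ → ℝ) (φ : EuclideanSpace ℝ (Fin d) → ℝ)
    (ε κ : ℝ) (x : EuclideanSpace ℝ (Fin d)) (t : ℝ) : ℂ :=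
  ∫ ξ, dampedIntegrand φ (cutoffPlus χ ε) κ x t ξ

/-- The oscillatory integral used for `α < 0`. -/
noncomputable def oscIntegralMinus {d : ℕ} (χ : ℝ → ℝ) (φ : EuclideanSpace ℝ (Fin d) → ℝ)
    (ε κ : ℝ) (x : EuclideanSpace ℝ (Fin d)) (t : ℝ) : ℂ :=
  ∫ ξ, dampedIntegrand φ (cutoffMinus χ ε) κ x t ξ

/-!
The estimate is proved by one global integration by parts, without dyadic decomposition or a Morse
lemma. Put `Φ = x·ξ + tφ(ξ)`, `s = |t| |ξ|^α` (`PhaseParams.size`) and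
`w = 1 + |ξ|² |∇Φ|² / s` (`PhaseParams.weight`). The operator
`L = w⁻¹ (1 - i (|ξ|² / s) ∇Φ·∇)` fixes `e^{iΦ}`, so an amplitude may be replaced by its image under
the transpose of `L` (`PhaseParams.integral_transposeOp`).

Each use of the transpose gains `ρ = w⁻¹ + (s w)^{-1/2}` (`PhaseParams.isSymbol_transposeOp`). The
bookkeeping is done in symbol classes: in the frame of `PhaseParams.oscFrame` a derivative costs
`g = (1 + s^{1/2} w^{-1/2}) / |ξ|`, every factor of the transpose is a symbol for this cost, and
`ρ = g · |ξ| (s w)^{-1/2}`, where `|ξ| (s w)^{-1/2}` is the size of the vector field in `L`. The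
symbol classes concern families of functions indexed by all the parameters `ε, κ, x, t`, so that
uniformity of the constants is built in, and the polynomial growth in `κ` comes from differentiating
`|det Hφ|^{1/2 + iκ}` at most `d` times (`SymbolFrame.IsSymbol.cpow`).

Since `φ` has `d + 2` derivatives and the amplitude `d`, the transpose can be used `d` times, and
`|det Hφ|^{1/2}` is comparable to `|ξ|^{d(α-2)/2}`, so that what is left is
`∫ |ξ|^{d(α-2)/2} ρ^d dξ ≤ C |t|^{-d/2}` over `s > c` (`PhaseParams.exists_lintegral_gain`). There
`ρ ≤ 2 (w⁻¹ + s⁻¹)`. The integral of `|ξ|^{d(α-2)/2} s^{-d}` is computed by scaling. Where `|∇Φ|` is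
not small compared with `|t| |ξ|^{α-1}`, `w` dominates a multiple of `s`. On the remaining resonant
set `|ξ|^{α-1}` is comparable to `|x| / |t|`; as `α ≠ 1` this is an annulus, covered by a bounded
number of balls `B(ζ, r|ζ|)`. On such a ball the lower bound for the Hessian gives
`|∇φ(ξ) - ∇φ(ξ')| ≥ c |ζ|^{α-2} |ξ - ξ'|`
(`IsAlmostHomogeneousWith.exists_le_norm_gradient_sub`); comparing with a point `ξ₀` at which `|∇Φ|`
is smallest, `w ≥ 1 + c |t| |ζ|^{α-2} |ξ - ξ₀|²`, and the integral over the ball is at most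
`C |t|^{-d/2}`, the exponent `d > d/2` making it converge.

The region `s ≤ C` is estimated by absolute values (`PhaseParams.exists_low_bound`). The smooth
cutoff between the two regions is `χ` itself at scale `|t|^{-1/α}`: for either sign of `α` the
oscillating part of the amplitude is `χ(A|ξ|) (1 - χ(B|ξ|))`, with `A = ε`, `B = |t|^{1/α}` for
`α > 0` and `A = |t|^{1/α}`, `B = ε⁻¹` for `α < 0`.
-/

/-! ### Symbol classes relative to a frame -/

/-- The data relative to which symbol classes on `ℝᵈ` are defined, for families indexed by `P`:
for each parameter an open set `U p` on which the symbols live, and the factor `g p` that one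
derivative is allowed to cost. -/
structure SymbolFrame (P : Type*) (d : ℕ) where
  U : P → Set (EuclideanSpace ℝ (Fin d))
  isOpen : ∀ p, IsOpen (U p)
  g : P → EuclideanSpace ℝ (Fin d) → ℝ
  g_nonneg : ∀ p, ∀ ξ ∈ U p, 0 ≤ g p ξ

/-- The partial derivative in the `i`-th coordinate of each member of a family of functions. -/
noncomputable def coordDeriv {P : Type*} {d : ℕ} (i : Fin d) (f : P → EuclideanSpace ℝ (Fin d) → ℂ)
    (p : P) (ξ : EuclideanSpace ℝ (Fin d)) : ℂ :=
  fderiv ℝ (f p) ξ (EuclideanSpace.single i (1 : ℝ))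

namespace SymbolFrame

variable {P : Type*} {d : ℕ}

/-- The family `f` is bounded on the domains of the frame by a constant multiple of the weight
`M`, with one constant for all parameters. -/
def BoundedBy (F : SymbolFrame P d) (M : P → EuclideanSpace ℝ (Fin d) → ℝ)
    (f : P → EuclideanSpace ℝ (Fin d) → ℂ) : Prop :=
  ∃ C : ℝ, 0 ≤ C ∧ ∀ p, ∀ ξ ∈ F.U p, ‖f p ξ‖ ≤ C * M p ξ

/-- Symbols of order of smoothness `k` and weight `M`: families of `C^k` functions whose partial
derivatives of order `j ≤ k` are `O(M g^j)`, uniformly in the parameter. The recursion on `k`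
through coordinate derivatives reduces the calculus to one derivative at a time. -/
def IsSymbol (F : SymbolFrame P d) : ℕ → (P → EuclideanSpace ℝ (Fin d) → ℝ) →
    (P → EuclideanSpace ℝ (Fin d) → ℂ) → Prop
  | 0, M, f => (∀ p, ContinuousOn (f p) (F.U p)) ∧ F.BoundedBy M f
  | k + 1, M, f => (∀ p, DifferentiableOn ℝ (f p) (F.U p)) ∧ F.BoundedBy M f ∧
      ∀ i, F.IsSymbol k (fun p ξ => M p ξ * F.g p ξ) (coordDeriv i f)

variable {F : SymbolFrame P d} {k : ℕ} {M M' : P → EuclideanSpace ℝ (Fin d) → ℝ}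
  {f h : P → EuclideanSpace ℝ (Fin d) → ℂ}

theorem IsSymbol.boundedBy (hf : F.IsSymbol k M f) : F.BoundedBy M f := by
  cases k with
  | zero => exact hf.2
  | succ k => exact hf.2.1

theorem IsSymbol.continuousOn (hf : F.IsSymbol k M f) (p : P) : ContinuousOn (f p) (F.U p) := by
  cases k with
  | zero => exact hf.1 p
  | succ k => exact (hf.1 p).continuousOn

theorem IsSymbol.differentiableAt (hf : F.IsSymbol (k + 1) M f) {p : P}
    {ξ : EuclideanSpace ℝ (Fin d)} (hξ : ξ ∈ F.U p) : DifferentiableAt ℝ (f p) ξ :=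
  (hf.1 p).differentiableAt ((F.isOpen p).mem_nhds hξ)

theorem IsSymbol.coordDeriv (hf : F.IsSymbol (k + 1) M f) (i : Fin d) :
    F.IsSymbol k (fun p ξ => M p ξ * F.g p ξ) (coordDeriv i f) :=
  hf.2.2 i

theorem BoundedBy.mono (hf : F.BoundedBy M f) {c : ℝ} (hc : 0 ≤ c)
    (hM : ∀ p, ∀ ξ ∈ F.U p, M p ξ ≤ c * M' p ξ) : F.BoundedBy M' f := by
  obtain ⟨C, hC, H⟩ := hf
  refine ⟨C * c, by positivity, fun p ξ hξ => (H p ξ hξ).trans ?_⟩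
  rw [mul_assoc]
  exact mul_le_mul_of_nonneg_left (hM p ξ hξ) hC

/-- Symbols may be measured against a larger weight. -/
theorem IsSymbol.mono (hf : F.IsSymbol k M f) {c : ℝ} (hc : 0 ≤ c)
    (hM : ∀ p, ∀ ξ ∈ F.U p, M p ξ ≤ c * M' p ξ) : F.IsSymbol k M' f := by
  induction k generalizing M M' f with
  | zero => exact ⟨hf.1, hf.2.mono hc hM⟩
  | succ k ih =>
    refine ⟨hf.1, hf.2.1.mono hc hM, fun i => ih (hf.2.2 i) fun p ξ hξ => ?_⟩
    rw [← mul_assoc]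
    exact mul_le_mul_of_nonneg_right (hM p ξ hξ) (F.g_nonneg p ξ hξ)

theorem IsSymbol.weight_congr (hf : F.IsSymbol k M f)
    (hM : ∀ p, ∀ ξ ∈ F.U p, M p ξ = M' p ξ) : F.IsSymbol k M' f :=
  hf.mono zero_le_one fun p ξ hξ => by rw [hM p ξ hξ, one_mul]

theorem IsSymbol.congr (hf : F.IsSymbol k M f)
    (hfh : ∀ p, ∀ ξ ∈ F.U p, h p ξ = f p ξ) : F.IsSymbol k M h := by
  induction k generalizing M f h with
  | zero =>
    refine ⟨fun p => (hf.1 p).congr (hfh p), ?_⟩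
    obtain ⟨C, hC, H⟩ := hf.2
    exact ⟨C, hC, fun p ξ hξ => by rw [hfh p ξ hξ]; exact H p ξ hξ⟩
  | succ k ih =>
    refine ⟨fun p => (hf.1 p).congr (hfh p), ?_, fun i => ih (hf.2.2 i) fun p ξ hξ => ?_⟩
    · obtain ⟨C, hC, H⟩ := hf.2.1
      exact ⟨C, hC, fun p ξ hξ => by rw [hfh p ξ hξ]; exact H p ξ hξ⟩
    · have : h p =ᶠ[nhds ξ] f p := by
        filter_upwards [(F.isOpen p).mem_nhds hξ] with η hη using hfh p η hη
      simp only [_root_.coordDeriv, this.fderiv_eq]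

theorem IsSymbol.of_succ (hf : F.IsSymbol (k + 1) M f) : F.IsSymbol k M f := by
  induction k generalizing M f with
  | zero => exact ⟨fun p => (hf.1 p).continuousOn, hf.2.1⟩
  | succ k ih => exact ⟨hf.1, hf.2.1, fun i => ih (hf.2.2 i)⟩

theorem IsSymbol.of_le {l : ℕ} (hf : F.IsSymbol k M f) (hl : l ≤ k) : F.IsSymbol l M f := by
  induction hl with
  | refl => exact hf
  | step _ ih => exact ih hf.of_succ

theorem IsSymbol.zero (hM : ∀ p, ∀ ξ ∈ F.U p, 0 ≤ M p ξ) :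
    F.IsSymbol k M (fun _ _ => 0) := by
  induction k generalizing M with
  | zero => exact ⟨fun p => continuousOn_const, 0, le_rfl, by simp⟩
  | succ k ih =>
    refine ⟨fun p => differentiableOn_const _, ⟨0, le_rfl, by simp⟩, fun i => ?_⟩
    refine (ih fun p ξ hξ => mul_nonneg (hM p ξ hξ) (F.g_nonneg p ξ hξ)).congr fun p ξ _ => ?_
    simp [_root_.coordDeriv]

/-- Functions of the parameter alone are symbols of every order. -/
theorem IsSymbol.const {c : P → ℂ} {C : ℝ} (hC : 0 ≤ C)
    (hc : ∀ p, ∀ ξ ∈ F.U p, ‖c p‖ ≤ C * M p ξ) (hM : ∀ p, ∀ ξ ∈ F.U p, 0 ≤ M p ξ) :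
    F.IsSymbol k M (fun p _ => c p) := by
  cases k with
  | zero => exact ⟨fun p => continuousOn_const, C, hC, hc⟩
  | succ k =>
    refine ⟨fun p => differentiableOn_const _, ⟨C, hC, hc⟩, fun i => ?_⟩
    refine (IsSymbol.zero fun p ξ hξ => mul_nonneg (hM p ξ hξ) (F.g_nonneg p ξ hξ)).congr
      fun p ξ _ => ?_
    simp [_root_.coordDeriv]

theorem BoundedBy.add (hf : F.BoundedBy M f) (hh : F.BoundedBy M h) :
    F.BoundedBy M (fun p ξ => f p ξ + h p ξ) := by
  obtain ⟨C, hC, H⟩ := hf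
  obtain ⟨C', hC', H'⟩ := hh
  refine ⟨C + C', by positivity, fun p ξ hξ => (norm_add_le _ _).trans ?_⟩
  rw [add_mul]
  exact add_le_add (H p ξ hξ) (H' p ξ hξ)

theorem BoundedBy.mul (hf : F.BoundedBy M f) (hh : F.BoundedBy M' h) :
    F.BoundedBy (fun p ξ => M p ξ * M' p ξ) (fun p ξ => f p ξ * h p ξ) := by
  obtain ⟨C, hC, H⟩ := hf
  obtain ⟨C', hC', H'⟩ := hh
  refine ⟨C * C', by positivity, fun p ξ hξ => ?_⟩
  rw [norm_mul, mul_mul_mul_comm]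
  exact mul_le_mul (H p ξ hξ) (H' p ξ hξ) (norm_nonneg _) ((norm_nonneg _).trans (H p ξ hξ))

theorem IsSymbol.add (hf : F.IsSymbol k M f) (hh : F.IsSymbol k M h) :
    F.IsSymbol k M (fun p ξ => f p ξ + h p ξ) := by
  induction k generalizing M f h with
  | zero => exact ⟨fun p => (hf.1 p).add (hh.1 p), hf.2.add hh.2⟩
  | succ k ih =>
    refine ⟨fun p => (hf.1 p).add (hh.1 p), hf.2.1.add hh.2.1, fun i => ?_⟩
    refine (ih (hf.2.2 i) (hh.2.2 i)).congr fun p ξ hξ => ?_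
    simp only [_root_.coordDeriv]
    rw [fderiv_fun_add (hf.differentiableAt hξ) (hh.differentiableAt hξ)]
    rfl

theorem IsSymbol.mul (hf : F.IsSymbol k M f) (hh : F.IsSymbol k M' h) :
    F.IsSymbol k (fun p ξ => M p ξ * M' p ξ) (fun p ξ => f p ξ * h p ξ) := by
  induction k generalizing M M' f h with
  | zero => exact ⟨fun p => (hf.1 p).mul (hh.1 p), hf.2.mul hh.2⟩
  | succ k ih =>
    refine ⟨fun p => (hf.1 p).mul (hh.1 p), hf.2.1.mul hh.2.1, fun i => ?_⟩
    have h1 := ih hf.of_succ (hh.2.2 i)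
    have h2 := ih (hf.2.2 i) hh.of_succ
    refine ((h1.weight_congr fun p ξ _ => ?_).add (h2.weight_congr fun p ξ _ => ?_)).congr
      fun p ξ hξ => ?_
    · ring
    · ring
    · simp only [_root_.coordDeriv]
      rw [fderiv_fun_mul (hf.differentiableAt hξ) (hh.differentiableAt hξ)]
      simp only [add_apply, smul_apply, smul_eq_mul]
      ring

theorem IsSymbol.sum {ι : Type*} (s : Finset ι) {f : ι → P → EuclideanSpace ℝ (Fin d) → ℂ}
    (hM : ∀ p, ∀ ξ ∈ F.U p, 0 ≤ M p ξ) (hf : ∀ i ∈ s, F.IsSymbol k M (f i)) :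
    F.IsSymbol k M (fun p ξ => ∑ i ∈ s, f i p ξ) := by
  classical
  induction s using Finset.induction_on with
  | empty => simpa using IsSymbol.zero hM
  | insert a s ha ih =>
    simp only [Finset.sum_insert ha]
    exact (hf a (by simp)).add (ih fun i hi => hf i (by simp [hi]))

theorem IsSymbol.prod {ι : Type*} (s : Finset ι) {f : ι → P → EuclideanSpace ℝ (Fin d) → ℂ}
    (hf : ∀ i ∈ s, F.IsSymbol k M (f i)) :
    F.IsSymbol k (fun p ξ => M p ξ ^ s.card) (fun p ξ => ∏ i ∈ s, f i p ξ) := by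
  classical
  induction s using Finset.induction_on with
  | empty =>
    simp only [Finset.prod_empty, Finset.card_empty, pow_zero]
    exact IsSymbol.const zero_le_one (by simp) (by simp)
  | insert a s ha ih =>
    simp only [Finset.prod_insert ha, Finset.card_insert_of_notMem ha, pow_succ']
    exact (hf a (by simp)).mul (ih fun i hi => hf i (by simp [hi]))

theorem IsSymbol.const_mul (hf : F.IsSymbol k M f) (c : ℂ) :
    F.IsSymbol k M (fun p ξ => c * f p ξ) := by
  have : F.IsSymbol k (fun _ _ => 1) (fun _ _ => c) :=
    IsSymbol.const (norm_nonneg c) (by simp) (by simp)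
  exact (this.mul hf).weight_congr (by simp)

/-- Reciprocals of elliptic symbols. -/
theorem IsSymbol.inv (hf : F.IsSymbol k M f) (hM : ∀ p, ∀ ξ ∈ F.U p, 0 < M p ξ) {c : ℝ}
    (hc : 0 < c) (hfM : ∀ p, ∀ ξ ∈ F.U p, c * M p ξ ≤ ‖f p ξ‖) :
    F.IsSymbol k (fun p ξ => (M p ξ)⁻¹) (fun p ξ => (f p ξ)⁻¹) := by
  have hne : ∀ p, ∀ ξ ∈ F.U p, f p ξ ≠ 0 := fun p ξ hξ h0 => by
    have := hfM p ξ hξ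
    rw [h0, norm_zero] at this
    exact absurd (mul_pos hc (hM p ξ hξ)) (not_lt.2 this)
  have hb : F.BoundedBy (fun p ξ => (M p ξ)⁻¹) (fun p ξ => (f p ξ)⁻¹) := by
    refine ⟨c⁻¹, by positivity, fun p ξ hξ => ?_⟩
    rw [norm_inv, ← mul_inv]
    exact inv_anti₀ (mul_pos hc (hM p ξ hξ)) (hfM p ξ hξ)
  induction k with
  | zero => exact ⟨fun p => (hf.1 p).inv₀ (hne p), hb⟩
  | succ k ih =>
    refine ⟨fun p => (hf.1 p).inv (hne p), hb, fun i => ?_⟩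
    have hi := ih hf.of_succ
    refine (((hf.2.2 i).mul (hi.mul hi)).const_mul (-1)).weight_congr (fun p ξ hξ => ?_) |>.congr
      fun p ξ hξ => ?_
    · have := (hM p ξ hξ).ne'
      field_simp
    · simp only [_root_.coordDeriv]
      have hd := ((hasDerivAt_inv (hne p ξ hξ)).comp_hasFDerivAt ξ
        (hf.differentiableAt hξ).hasFDerivAt).fderiv
      have : (fun ξ => (f p ξ)⁻¹) = (fun y => y⁻¹) ∘ f p := rfl
      rw [this, hd]
      simp only [smul_apply, smul_eq_mul]
      field_simp

/-- Complex powers of positive elliptic symbols. Every derivative of `f ^ z` produces a factor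
`z`, whose size is recorded in the weight `N`. -/
theorem IsSymbol.cpow {f : P → EuclideanSpace ℝ (Fin d) → ℝ}
    (hf : F.IsSymbol k M (fun p ξ => (f p ξ : ℂ))) (hM : ∀ p, ∀ ξ ∈ F.U p, 0 < M p ξ) {c : ℝ}
    (hc : 0 < c) (hfM : ∀ p, ∀ ξ ∈ F.U p, c * M p ξ ≤ f p ξ) {z : P → ℂ} {β : ℝ}
    (hz : ∀ p, (z p).re = β) {N : P → ℝ} (hN : ∀ p, 1 ≤ N p) {K : ℝ} (hK : 0 ≤ K)
    (hzN : ∀ p, ‖z p‖ ≤ K * N p) :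
    F.IsSymbol k (fun p ξ => M p ξ ^ β * N p ^ k) (fun p ξ => (f p ξ : ℂ) ^ z p) := by
  have hpos : ∀ p, ∀ ξ ∈ F.U p, 0 < f p ξ := fun p ξ hξ =>
    (mul_pos hc (hM p ξ hξ)).trans_le (hfM p ξ hξ)
  have hslit : ∀ p, ∀ ξ ∈ F.U p, (f p ξ : ℂ) ∈ Complex.slitPlane := fun p ξ hξ =>
    Complex.ofReal_mem_slitPlane.2 (hpos p ξ hξ)
  have hb : F.BoundedBy (fun p ξ => M p ξ ^ β) (fun p ξ => (f p ξ : ℂ) ^ z p) := by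
    obtain ⟨C, hC, H⟩ := hf.boundedBy
    refine ⟨C ^ β + c ^ β, by positivity, fun p ξ hξ => ?_⟩
    have hMp := hM p ξ hξ
    have hfp := hpos p ξ hξ
    have hup : f p ξ ≤ C * M p ξ := by
      have := H p ξ hξ
      rwa [Complex.norm_real, Real.norm_of_nonneg hfp.le] at this
    rw [Complex.norm_cpow_eq_rpow_re_of_pos hfp, hz, add_mul]
    have h1 : 0 ≤ C ^ β * M p ξ ^ β := by positivity
    have h2 : 0 ≤ c ^ β * M p ξ ^ β := by positivity
    rcases le_total 0 β with hβ | hβ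
    · have := Real.rpow_le_rpow hfp.le hup hβ
      rw [Real.mul_rpow hC hMp.le] at this
      linarith
    · have := Real.rpow_le_rpow_of_nonpos (mul_pos hc hMp) (hfM p ξ hξ) hβ
      rw [Real.mul_rpow hc.le hMp.le] at this
      linarith
  have hb' : ∀ k : ℕ, F.BoundedBy (fun p ξ => M p ξ ^ β * N p ^ k)
      (fun p ξ => (f p ξ : ℂ) ^ z p) := fun k => by
    refine hb.mono zero_le_one fun p ξ hξ => ?_
    have : 0 ≤ M p ξ ^ β := Real.rpow_nonneg (hM p ξ hξ).le _
    rw [one_mul]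
    exact le_mul_of_one_le_right this (one_le_pow₀ (hN p))
  induction k with
  | zero => exact ⟨fun p => (hf.1 p).cpow continuousOn_const (hslit p), hb' 0⟩
  | succ k ih =>
    have hd : ∀ p, ∀ ξ ∈ F.U p, HasFDerivAt (fun ξ => (f p ξ : ℂ) ^ z p)
        ((z p * (f p ξ : ℂ) ^ (z p - 1)) • fderiv ℝ (fun ξ => (f p ξ : ℂ)) ξ) ξ := by
      intro p ξ hξ
      have h1 : HasDerivAt (fun y : ℂ => y ^ z p) (z p * (f p ξ : ℂ) ^ (z p - 1)) (f p ξ : ℂ) := by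
        simpa using (hasDerivAt_id (f p ξ : ℂ)).cpow_const (c := z p) (hslit p ξ hξ)
      exact h1.comp_hasFDerivAt ξ (hf.differentiableAt hξ).hasFDerivAt
    refine ⟨fun p ξ hξ => (hd p ξ hξ).differentiableAt.differentiableWithinAt, hb' (k + 1),
      fun i => ?_⟩
    have h1 := ih hf.of_succ
    have h2 := hf.of_succ.inv hM hc fun p ξ hξ => by
      rw [Complex.norm_real, Real.norm_of_nonneg (hpos p ξ hξ).le]; exact hfM p ξ hξ
    have h3 : F.IsSymbol k (fun p _ => N p) (fun p _ => z p) :=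
      IsSymbol.const hK (fun p ξ _ => hzN p) fun p ξ _ => zero_le_one.trans (hN p)
    refine ((h3.mul h1).mul (h2.mul (hf.2.2 i))).weight_congr (fun p ξ hξ => ?_) |>.congr
      fun p ξ hξ => ?_
    · have := (hM p ξ hξ).ne'
      field_simp
      ring
    · simp only [_root_.coordDeriv]
      rw [(hd p ξ hξ).fderiv, Complex.cpow_sub _ _ (by exact_mod_cast (hpos p ξ hξ).ne'),
        Complex.cpow_one]
      simp only [smul_apply, smul_eq_mul]
      field_simp

/-- Symbols for a frame are symbols for every frame with smaller domains and a larger cost. -/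
theorem IsSymbol.change_frame {Q : Type*} {G : SymbolFrame Q d} (π : Q → P)
    (hf : F.IsSymbol k M f)
    (hU : ∀ q, G.U q ⊆ F.U (π q)) (hM : ∀ p, ∀ ξ ∈ F.U p, 0 ≤ M p ξ) {c : ℝ} (hc : 0 ≤ c)
    (hg : ∀ q, ∀ ξ ∈ G.U q, F.g (π q) ξ ≤ c * G.g q ξ) :
    G.IsSymbol k (fun q => M (π q)) (fun q => f (π q)) := by
  have hb : ∀ {M f}, F.BoundedBy M f → G.BoundedBy (fun q => M (π q)) (fun q => f (π q)) := by
    rintro M f ⟨C, hC, H⟩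
    exact ⟨C, hC, fun p ξ hξ => H _ ξ (hU p hξ)⟩
  induction k generalizing M f with
  | zero => exact ⟨fun p => (hf.1 _).mono (hU p), hb hf.2⟩
  | succ k ih =>
    refine ⟨fun p => (hf.1 _).mono (hU p), hb hf.2.1, fun i => ?_⟩
    refine (ih (hf.2.2 i) fun p ξ hξ => mul_nonneg (hM p ξ hξ) (F.g_nonneg p ξ hξ)).mono
      (c := c) hc fun p ξ hξ => ?_
    rw [mul_left_comm]
    exact mul_le_mul_of_nonneg_left (hg p ξ hξ) (hM _ ξ (hU p hξ))

end SymbolFrame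

/-! ### Classical symbols: powers, cutoffs, the phase and the damping factor -/

/-- The frame of classical symbols on `ℝᵈ ∖ {0}`: a derivative costs `|ξ|⁻¹`. -/
noncomputable def puncturedFrame (P : Type*) (d : ℕ) : SymbolFrame P d where
  U _ := {0}ᶜ
  isOpen _ := isOpen_compl_singleton
  g _ ξ := ‖ξ‖⁻¹
  g_nonneg _ ξ _ := by positivity

section Classical

open SymbolFrame

variable {P : Type*} {d k : ℕ}

theorem coordDeriv_ofReal {h : P → EuclideanSpace ℝ (Fin d) → ℝ} {p : P}
    {ξ : EuclideanSpace ℝ (Fin d)} (hd : DifferentiableAt ℝ (h p) ξ) (i : Fin d) :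
    coordDeriv i (fun p ξ => (h p ξ : ℂ)) p ξ =
      (fderiv ℝ (h p) ξ (EuclideanSpace.single i (1 : ℝ)) : ℝ) := by
  have := (Complex.ofRealCLM.hasFDerivAt.comp ξ hd.hasFDerivAt).fderiv
  have h2 : (fun ξ => (h p ξ : ℂ)) = Complex.ofRealCLM ∘ h p := rfl
  rw [coordDeriv, h2, this]
  rfl

theorem EuclideanSpace.abs_apply_le_norm (ξ : EuclideanSpace ℝ (Fin d)) (i : Fin d) :
    |ξ i| ≤ ‖ξ‖ := by
  simpa using PiLp.norm_apply_le ξ i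

theorem isSymbol_coord (i : Fin d) : (puncturedFrame P d).IsSymbol k (fun _ ξ => ‖ξ‖)
    (fun _ ξ => ((ξ i : ℝ) : ℂ)) := by
  have hb : (puncturedFrame P d).BoundedBy (fun _ ξ => ‖ξ‖) (fun _ ξ => ((ξ i : ℝ) : ℂ)) :=
    ⟨1, zero_le_one, fun p ξ _ => by
      rw [one_mul, Complex.norm_real]; exact EuclideanSpace.abs_apply_le_norm ξ i⟩
  have hd : ∀ ξ : EuclideanSpace ℝ (Fin d), HasFDerivAt (fun ξ : EuclideanSpace ℝ (Fin d) => ξ i)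
    (EuclideanSpace.proj i : EuclideanSpace ℝ (Fin d) →L[ℝ] ℝ) ξ := fun ξ =>
      (EuclideanSpace.proj i : EuclideanSpace ℝ (Fin d) →L[ℝ] ℝ).hasFDerivAt
  have hc : Differentiable ℝ (fun ξ : EuclideanSpace ℝ (Fin d) => ((ξ i : ℝ) : ℂ)) := fun ξ =>
    Complex.ofRealCLM.differentiableAt.comp ξ (hd ξ).differentiableAt
  cases k with
  | zero => exact ⟨fun p => hc.continuous.continuousOn, hb⟩
  | succ k =>
    refine ⟨fun p => hc.differentiableOn, hb, fun j => ?_⟩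
    have : (puncturedFrame P d).IsSymbol k (fun _ ξ => ‖ξ‖ * ‖ξ‖⁻¹)
        (fun _ _ => (((EuclideanSpace.single j (1 : ℝ) : EuclideanSpace ℝ (Fin d)) i : ℝ) : ℂ)) := by
      refine IsSymbol.const zero_le_one (fun p ξ hξ => ?_) fun p ξ hξ => by positivity
      rw [mul_inv_cancel₀ (norm_ne_zero_iff.2 hξ), one_mul, Complex.norm_real]
      exact (EuclideanSpace.abs_apply_le_norm _ _).trans (by simp)
    refine this.congr fun p ξ hξ => ?_
    have h2 := coordDeriv_ofReal (P := P) (h := fun _ ξ => ξ i) (p := p) (hd ξ).differentiableAt j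
    rw [h2, (hd ξ).fderiv]
    rfl

theorem isSymbol_norm_sq : (puncturedFrame P d).IsSymbol k (fun _ ξ => ‖ξ‖ ^ 2)
    (fun _ ξ => ((‖ξ‖ ^ 2 : ℝ) : ℂ)) := by
  have := IsSymbol.sum (F := puncturedFrame P d) (k := k) (M := fun _ ξ => ‖ξ‖ * ‖ξ‖) Finset.univ
    (f := fun i _ ξ => ((ξ i : ℝ) : ℂ) * ((ξ i : ℝ) : ℂ))
    (fun p ξ _ => by positivity) fun i _ => (isSymbol_coord i).mul (isSymbol_coord i)
  refine (this.weight_congr fun p ξ _ => (sq _).symm).congr fun p ξ _ => ?_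
  rw [EuclideanSpace.real_norm_sq_eq]
  push_cast
  simp only [sq]

theorem isSymbol_norm_rpow (β : ℝ) : (puncturedFrame P d).IsSymbol k (fun _ ξ => ‖ξ‖ ^ β)
    (fun _ ξ => ((‖ξ‖ ^ β : ℝ) : ℂ)) := by
  have h := (isSymbol_norm_sq (P := P) (d := d) (k := k)).cpow (f := fun _ ξ => ‖ξ‖ ^ 2)
    (fun p ξ hξ => by have := norm_pos_iff.2 hξ; positivity) one_pos
    (fun p ξ _ => by rw [one_mul]) (z := fun _ => ((β / 2 : ℝ) : ℂ)) (β := β / 2)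
    (fun p => Complex.ofReal_re _) (N := fun _ => 1) (fun p => le_rfl) (norm_nonneg _)
    (fun p => (mul_one ‖((β / 2 : ℝ) : ℂ)‖).ge)
  have key : ∀ ξ : EuclideanSpace ℝ (Fin d), (‖ξ‖ ^ 2) ^ (β / 2) = ‖ξ‖ ^ β := fun ξ => by
    rw [← Real.rpow_natCast, ← Real.rpow_mul (norm_nonneg _)]
    congr 1
    push_cast
    ring
  refine (h.weight_congr fun p ξ _ => ?_).congr fun p ξ _ => ?_
  · rw [key, one_pow, mul_one]
  · rw [← Complex.ofReal_cpow (by positivity), key]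

/-- Smooth functions of a real variable that are constant on `[1, ∞)`. The class is stable under
`ψ ↦ r ψ'(r)`, the operation that differentiation of `ψ(c|ξ|)` produces. -/
structure IsRadialProfile (ψ : ℝ → ℝ) : Prop where
  smooth : ContDiff ℝ ∞ ψ
  eventually_const : ∃ c, ∀ r, 1 ≤ r → ψ r = c

theorem IsRadialProfile.bounded {ψ : ℝ → ℝ} (hψ : IsRadialProfile ψ) :
    ∃ C, 0 ≤ C ∧ ∀ r, 0 ≤ r → |ψ r| ≤ C := by
  obtain ⟨C, hC⟩ := (isCompact_Icc (a := (0 : ℝ)) (b := 1)).exists_bound_of_continuousOn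
    hψ.smooth.continuous.continuousOn
  obtain ⟨c, hc⟩ := hψ.eventually_const
  have h0 : 0 ≤ C := (norm_nonneg _).trans (hC 0 (by simp))
  refine ⟨C + |c|, by positivity, fun r hr => ?_⟩
  rcases le_total r 1 with h | h
  · have := hC r ⟨hr, h⟩
    rw [Real.norm_eq_abs] at this
    linarith [abs_nonneg c]
  · rw [hc r h]
    linarith

theorem IsRadialProfile.mul_deriv {ψ : ℝ → ℝ} (hψ : IsRadialProfile ψ) :
    IsRadialProfile (fun r => r * deriv ψ r) := by
  have hd : ContDiff ℝ ∞ (deriv ψ) := (contDiff_infty_iff_deriv.1 hψ.smooth).2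
  refine ⟨contDiff_id.mul hd, 0, fun r hr => ?_⟩
  obtain ⟨c, hc⟩ := hψ.eventually_const
  have h1 : Set.EqOn (deriv ψ) (fun _ => 0) (Set.Ioi 1) := fun s hs => by
    have : ψ =ᶠ[nhds s] fun _ => c := by
      filter_upwards [Ioi_mem_nhds hs] with y hy using hc y (le_of_lt hy)
    rw [this.deriv_eq]
    simp
  have h2 := h1.closure hd.continuous continuous_const
  rw [closure_Ioi] at h2
  rw [h2 hr, mul_zero]

/-- Radial cutoffs are symbols of weight one, uniformly in the scale `c p`. -/
theorem isSymbol_radial {ψ : ℝ → ℝ} (hψ : IsRadialProfile ψ) (c : P → ℝ) (hc : ∀ p, 0 < c p) :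
    (puncturedFrame P d).IsSymbol k (fun _ _ => 1) (fun p ξ => ((ψ (c p * ‖ξ‖) : ℝ) : ℂ)) := by
  have hb : ∀ {ψ : ℝ → ℝ}, IsRadialProfile ψ → (puncturedFrame P d).BoundedBy (fun _ _ => 1)
      (fun p ξ => ((ψ (c p * ‖ξ‖) : ℝ) : ℂ)) := by
    intro ψ hψ
    obtain ⟨C, hC, H⟩ := hψ.bounded
    refine ⟨C, hC, fun p ξ _ => ?_⟩
    rw [Complex.norm_real, mul_one]
    exact H _ (mul_nonneg (hc p).le (norm_nonneg _))
  have hn : ∀ ξ : EuclideanSpace ℝ (Fin d), ξ ≠ 0 → HasFDerivAt (fun η => ‖η‖)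
      (‖ξ‖⁻¹ • innerSL ℝ ξ) ξ := fun ξ hξ => by
    have h1 := (hasStrictFDerivAt_norm_sq ξ).hasFDerivAt.sqrt
      (by have := norm_pos_iff.2 hξ; positivity)
    simp only [Real.sqrt_sq (norm_nonneg _)] at h1
    refine h1.congr_fderiv ?_
    ext v
    simp
    ring
  have hd : ∀ {ψ : ℝ → ℝ}, IsRadialProfile ψ → ∀ p, ∀ ξ : EuclideanSpace ℝ (Fin d), ξ ≠ 0 →
      HasFDerivAt (fun ξ => ψ (c p * ‖ξ‖)) ((deriv ψ (c p * ‖ξ‖)) • c p • ‖ξ‖⁻¹ • innerSL ℝ ξ) ξ := by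
    intro ψ hψ p ξ hξ
    have h1 : HasDerivAt ψ (deriv ψ (c p * ‖ξ‖)) (c p * ‖ξ‖) :=
      (hψ.smooth.differentiable (by simp)).differentiableAt.hasDerivAt
    exact h1.comp_hasFDerivAt ξ ((hn ξ hξ).const_mul (c p))
  have hdc : ∀ {ψ : ℝ → ℝ}, IsRadialProfile ψ → ∀ p, DifferentiableOn ℝ
      (fun ξ : EuclideanSpace ℝ (Fin d) => ((ψ (c p * ‖ξ‖) : ℝ) : ℂ)) {0}ᶜ := by
    intro ψ hψ p ξ hξ
    exact (Complex.ofRealCLM.differentiableAt.comp ξ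
      (hd hψ p ξ hξ).differentiableAt).differentiableWithinAt
  induction k generalizing ψ with
  | zero => exact ⟨fun p => (hdc hψ p).continuousOn, hb hψ⟩
  | succ k ih =>
    refine ⟨hdc hψ, hb hψ, fun i => ?_⟩
    refine (((ih hψ.mul_deriv).mul ((isSymbol_coord i).mul
      (isSymbol_norm_rpow (-2)))).weight_congr fun p ξ hξ => ?_).congr fun p ξ hξ => ?_
    · have hξ' : 0 < ‖ξ‖ := norm_pos_iff.2 hξ
      simp only [puncturedFrame]
      rw [Real.rpow_neg hξ'.le, Real.rpow_two]
      field_simp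
    · have hξ' : 0 < ‖ξ‖ := norm_pos_iff.2 hξ
      have h2 := coordDeriv_ofReal (P := P) (h := fun p ξ => ψ (c p * ‖ξ‖)) (p := p)
        (hd hψ p ξ hξ).differentiableAt i
      rw [h2, (hd hψ p ξ hξ).fderiv, Real.rpow_neg hξ'.le, Real.rpow_two, ← Complex.ofReal_mul,
        ← Complex.ofReal_mul]
      congr 1
      simp [EuclideanSpace.inner_single_right]
      field_simp

theorem differentiableAt_and_fderiv_partialDeriv {φ : EuclideanSpace ℝ (Fin d) → ℝ} {m : ℕ}
    (hφ : ContDiffOn ℝ (m : ℕ∞) φ {0}ᶜ) {n : ℕ} (hn : n < m) (i : Fin n → Fin d)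
    {ξ : EuclideanSpace ℝ (Fin d)} (hξ : ξ ≠ 0) :
    DifferentiableAt ℝ (partialDeriv φ i) ξ ∧ ∀ j, fderiv ℝ (partialDeriv φ i) ξ
      (EuclideanSpace.single j (1 : ℝ)) = partialDeriv φ (Fin.cons j i : Fin (n + 1) → Fin d) ξ := by
  have hat : ContDiffAt ℝ (m : ℕ∞) φ ξ := hφ.contDiffAt (isOpen_compl_singleton.mem_nhds hξ)
  have h1 : DifferentiableAt ℝ (iteratedFDeriv ℝ n φ) ξ :=
    hat.differentiableAt_iteratedFDeriv (by exact_mod_cast hn)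
  have h2 := h1.hasFDerivAt.continuousMultilinear_apply_const
    (fun k => EuclideanSpace.single (i k) (1 : ℝ))
  refine ⟨h2.differentiableAt, fun j => ?_⟩
  have h3 : partialDeriv φ i = fun y => iteratedFDeriv ℝ n φ y
    (fun k => EuclideanSpace.single (i k) (1 : ℝ)) := rfl
  rw [h3, h2.fderiv]
  simp only [partialDeriv, iteratedFDeriv_succ_apply_left]
  simp [ContinuousLinearMap.flipMultilinear, Fin.tail_def]

theorem partialDeriv_one (φ : EuclideanSpace ℝ (Fin d) → ℝ) (j : Fin d)
    (ξ : EuclideanSpace ℝ (Fin d)) :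
    partialDeriv φ ![j] ξ = fderiv ℝ φ ξ (EuclideanSpace.single j (1 : ℝ)) := by
  simp [partialDeriv, iteratedFDeriv_one_apply]

variable {α B lam d₁ d₂ : ℝ} {φ : EuclideanSpace ℝ (Fin d) → ℝ}

theorem IsAlmostHomogeneousWith.isSymbol_partialDeriv
    (hφ : IsAlmostHomogeneousWith α B lam d₁ d₂ φ) (hB : 0 ≤ B) {n k : ℕ} (hnk : n + k ≤ d + 2)
    (i : Fin n → Fin d) :
    (puncturedFrame P d).IsSymbol k (fun _ ξ => ‖ξ‖ ^ (α - n))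
      (fun _ ξ => ((partialDeriv φ i ξ : ℝ) : ℂ)) := by
  have hb : ∀ {n : ℕ} (i : Fin n → Fin d), n ≤ d + 2 → (puncturedFrame P d).BoundedBy
      (fun _ ξ => ‖ξ‖ ^ (α - n)) (fun _ ξ => ((partialDeriv φ i ξ : ℝ) : ℂ)) := by
    intro n i hn
    exact ⟨B, hB, fun p ξ hξ => by rw [Complex.norm_real]; exact hφ.deriv_le ξ hξ n hn i⟩
  induction k generalizing n with
  | zero =>
    refine ⟨fun p ξ hξ => ?_, hb i hnk⟩
    have hat : ContDiffAt ℝ ((d + 2 : ℕ) : ℕ∞) φ ξ :=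
      hφ.contDiffOn.contDiffAt (isOpen_compl_singleton.mem_nhds hξ)
    have h1 := (hat.iteratedFDeriv_right (i := n) (m := 0)
      (by simp only [zero_add]; exact_mod_cast hnk)).continuousAt
    have h2 : ContinuousAt (partialDeriv φ i) ξ := h1.eval_const _
    exact (Complex.continuous_ofReal.continuousAt.comp h2).continuousWithinAt
  | succ k ih =>
    have hd := fun ξ (hξ : ξ ≠ 0) => differentiableAt_and_fderiv_partialDeriv hφ.contDiffOn
      (by omega : n < d + 2) i hξ
    refine ⟨fun p ξ hξ => (Complex.ofRealCLM.differentiableAt.comp ξ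
      (hd ξ hξ).1).differentiableWithinAt, hb i (by omega), fun j => ?_⟩
    refine ((ih (n := n + 1) (by omega) (Fin.cons j i)).weight_congr fun p ξ hξ => ?_).congr
      fun p ξ hξ => ?_
    · have hξ' : 0 < ‖ξ‖ := norm_pos_iff.2 hξ
      simp only [puncturedFrame]
      rw [← Real.rpow_neg_one, ← Real.rpow_add hξ']
      congr 1
      push_cast
      ring
    · rw [coordDeriv_ofReal (h := fun _ => partialDeriv φ i) (p := p) (hd ξ hξ).1 j, (hd ξ hξ).2 j]

theorem IsAlmostHomogeneousWith.isSymbol_det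
    (hφ : IsAlmostHomogeneousWith α B lam d₁ d₂ φ) (hB : 0 ≤ B) :
    (puncturedFrame P d).IsSymbol d (fun _ ξ => ‖ξ‖ ^ (d * (α - 2)))
      (fun _ ξ => (((hessianMatrix φ ξ).det : ℝ) : ℂ)) := by
  have h : (puncturedFrame P d).IsSymbol d (fun _ ξ => ‖ξ‖ ^ (d * (α - 2)))
      (fun _ ξ => ∑ σ : Equiv.Perm (Fin d), ((Equiv.Perm.sign σ : ℤ) : ℂ) *
        ∏ i, ((hessianMatrix φ ξ (σ i) i : ℝ) : ℂ)) := by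
    refine IsSymbol.sum _ (fun p ξ _ => by positivity) fun σ _ => IsSymbol.const_mul ?_ _
    have := IsSymbol.prod (F := puncturedFrame P d) (k := d) (M := fun _ ξ => ‖ξ‖ ^ (α - (2 : ℕ)))
      Finset.univ (f := fun i _ ξ => ((hessianMatrix φ ξ (σ i) i : ℝ) : ℂ)) fun i _ =>
        hφ.isSymbol_partialDeriv hB (by omega) ![σ i, i]
    refine this.weight_congr fun p ξ hξ => ?_
    rw [← Real.rpow_natCast, ← Real.rpow_mul (norm_nonneg _)]
    congr 1
    simp
    ring
  refine h.congr fun p ξ _ => ?_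
  rw [Matrix.det_apply']
  push_cast
  rfl

open Matrix in
/-- A matrix that expands every vector by at least `m` has determinant at least `m ^ d`, because
the eigenvalues of `AᵀA` are at least `m²`. -/
theorem Matrix.pow_le_abs_det {A : Matrix (Fin d) (Fin d) ℝ} {m : ℝ} (hm : 0 ≤ m)
    (hA : ∀ v : EuclideanSpace ℝ (Fin d), ‖v‖ = 1 → m ≤ ‖Matrix.toEuclideanLin A v‖) :
    m ^ d ≤ |A.det| := by
  have hH : (Aᵀ * A).IsHermitian := by
    have := Matrix.isHermitian_conjTranspose_mul_self A
    simpa using this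
  have hdet : A.det ^ 2 = ∏ i, hH.eigenvalues i := by
    have := hH.det_eq_prod_eigenvalues
    rw [det_mul, det_transpose] at this
    rw [sq, this]
    simp
  have hev : ∀ i, m ^ 2 ≤ hH.eigenvalues i := fun i => by
    set v := hH.eigenvectorBasis i with hv
    have hn : ‖v‖ = 1 := hH.eigenvectorBasis.orthonormal.1 i
    have h1 := hH.mulVec_eigenvectorBasis i
    have h2 : ‖Matrix.toEuclideanLin A v‖ ^ 2 = hH.eigenvalues i := by
      have h3 : ‖Matrix.toEuclideanLin A v‖ ^ 2 = (A *ᵥ v.ofLp) ⬝ᵥ (A *ᵥ v.ofLp) := by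
        rw [EuclideanSpace.real_norm_sq_eq]
        simp [dotProduct, sq, Matrix.toLpLin_apply]
      have h4 : v.ofLp ⬝ᵥ v.ofLp = 1 := by
        have : ‖v‖ ^ 2 = 1 := by rw [hn, one_pow]
        rw [EuclideanSpace.real_norm_sq_eq] at this
        simpa [dotProduct, sq] using this
      rw [h3, dotProduct_mulVec, ← mulVec_transpose, mulVec_mulVec, h1, smul_dotProduct, h4]
      simp
    rw [← h2]
    exact pow_le_pow_left₀ hm (hA v hn) 2
  have : (m ^ d) ^ 2 ≤ |A.det| ^ 2 := by
    rw [sq_abs, hdet, ← pow_mul, mul_comm, pow_mul]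
    calc (m ^ 2) ^ d = ∏ _i : Fin d, m ^ 2 := by simp
      _ ≤ _ := Finset.prod_le_prod (fun _ _ => by positivity) fun i _ => hev i
  exact (pow_le_pow_iff_left₀ (by positivity) (abs_nonneg _) two_ne_zero).1 this

theorem IsAlmostHomogeneousWith.le_abs_det
    (hφ : IsAlmostHomogeneousWith α B lam d₁ d₂ φ) (hlam : 0 ≤ lam)
    {ξ : EuclideanSpace ℝ (Fin d)} (hξ : ξ ≠ 0) :
    lam ^ d * ‖ξ‖ ^ (d * (α - 2)) ≤ |(hessianMatrix φ ξ).det| := by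
  have := Matrix.pow_le_abs_det (by positivity) (hφ.hessian ξ hξ)
  rwa [mul_pow, ← Real.rpow_natCast (‖ξ‖ ^ (α - 2)), ← Real.rpow_mul (norm_nonneg _),
    mul_comm _ (d : ℝ)] at this

/-- The damping factor `|det Hφ|^{1/2 + iκ}` is a classical symbol. It is written as the power
`1/4 + iκ/2` of `(det Hφ)²`, a smooth function of the entries. -/
theorem IsAlmostHomogeneousWith.isSymbol_damping
    (hφ : IsAlmostHomogeneousWith α B lam d₁ d₂ φ) (hB : 0 ≤ B) (hlam : 0 < lam) (κ : P → ℝ) :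
    (puncturedFrame P d).IsSymbol d (fun p ξ => ‖ξ‖ ^ (d * (α - 2) / 2) * (1 + |κ p|) ^ d)
      (fun p ξ => ((|(hessianMatrix φ ξ).det| : ℝ) : ℂ) ^ ((1 / 2 : ℂ) + Complex.I * (κ p : ℂ))) := by
  have h1 := (hφ.isSymbol_det (P := P) hB).mul (hφ.isSymbol_det (P := P) hB)
  have h2 : (puncturedFrame P d).IsSymbol d (fun _ ξ => (‖ξ‖ ^ (d * (α - 2))) ^ 2)
      (fun _ ξ => (((hessianMatrix φ ξ).det ^ 2 : ℝ) : ℂ)) :=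
    (h1.weight_congr fun p ξ _ => (sq _).symm).congr fun p ξ _ => by push_cast; rw [sq]
  have h3 := h2.cpow (f := fun _ ξ => (hessianMatrix φ ξ).det ^ 2)
    (fun p ξ hξ => by have := norm_pos_iff.2 hξ; positivity) (c := (lam ^ d) ^ 2) (by positivity)
    (fun p ξ hξ => by
      rw [← mul_pow, ← sq_abs (Matrix.det _)]
      exact pow_le_pow_left₀ (by positivity) (hφ.le_abs_det hlam.le hξ) 2)
    (z := fun p => (1 / 4 : ℂ) + Complex.I * ((κ p / 2 : ℝ) : ℂ)) (β := 1 / 4)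
    (fun p => by simp) (N := fun p => 1 + |κ p|) (fun p => by linarith [abs_nonneg (κ p)])
    zero_le_one (fun p => by
      refine (norm_add_le _ _).trans ?_
      rw [norm_mul, Complex.norm_I, Complex.norm_real, Real.norm_eq_abs, abs_div]
      norm_num
      linarith [abs_nonneg (κ p)])
  refine (h3.weight_congr fun p ξ hξ => ?_).congr fun p ξ hξ => ?_
  · congr 1
    rw [← Real.rpow_natCast, ← Real.rpow_mul (norm_nonneg _), ← Real.rpow_mul (norm_nonneg _)]
    congr 1
    push_cast
    ring
  · have hD : 0 < |(hessianMatrix φ ξ).det| :=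
      lt_of_lt_of_le (by have := norm_pos_iff.2 hξ; positivity) (hφ.le_abs_det hlam.le hξ)
    -- the principal logarithm is additive here because the base is positive
    have hlog : Complex.log ((|(hessianMatrix φ ξ).det| ^ 2 : ℝ) : ℂ) =
        2 * Complex.log ((|(hessianMatrix φ ξ).det| : ℝ) : ℂ) := by
      rw [← Complex.ofReal_log (by positivity), ← Complex.ofReal_log hD.le, Real.log_pow]
      push_cast
      ring
    rw [← sq_abs (Matrix.det _), Complex.cpow_def_of_ne_zero (by exact_mod_cast hD.ne'),
      Complex.cpow_def_of_ne_zero (by exact_mod_cast (pow_pos hD 2).ne'), hlog]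
    congr 1
    push_cast
    ring

end Classical

/-! ### The weight, the transposed operator and integration by parts -/

/-- The parameters of the oscillatory integrals: the scales `A`, `B` of the two cutoffs in the
amplitude `χ(A|ξ|) (1 - χ(B|ξ|))`, the imaginary exponent `κ`, and the point `(x, t)` with
`t ≠ 0`. -/
structure PhaseParams (d : ℕ) where
  A : ℝ
  B : ℝ
  κ : ℝ
  t : ℝ
  x : EuclideanSpace ℝ (Fin d)
  A_pos : 0 < A
  B_pos : 0 < B
  t_ne : t ≠ 0

namespace PhaseParams

open SymbolFrame

variable {d : ℕ} (α c : ℝ) (φ : EuclideanSpace ℝ (Fin d) → ℝ)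

/-- The size `s = |t| |ξ|^α` of the phase `tφ` at `ξ`. -/
noncomputable def size (p : PhaseParams d) (ξ : EuclideanSpace ℝ (Fin d)) : ℝ :=
  |p.t| * ‖ξ‖ ^ α

/-- The `j`-th partial derivative `x_j + t ∂_jφ` of the phase. -/
noncomputable def phaseGrad (j : Fin d) (p : PhaseParams d) (ξ : EuclideanSpace ℝ (Fin d)) : ℝ :=
  p.x j + p.t * partialDeriv φ ![j] ξ

/-- The weight `w = 1 + |ξ|² |∇Φ|² / s`, where `Φ` is the phase; the factor `|ξ|² / s` is written
as `|ξ|^{2-α} / |t|`. -/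
noncomputable def weight (p : PhaseParams d) (ξ : EuclideanSpace ℝ (Fin d)) : ℝ :=
  1 + ‖ξ‖ ^ (2 - α) / |p.t| * ∑ j, p.phaseGrad φ j ξ ^ 2

/-- The oscillating factor `e^{i(x·ξ + tφ(ξ))}`. -/
noncomputable def phaseExp (p : PhaseParams d) (ξ : EuclideanSpace ℝ (Fin d)) : ℂ :=
  Complex.exp (Complex.I * ((inner ℝ p.x ξ + p.t * φ ξ : ℝ) : ℂ))

variable {α c φ}

theorem abs_t_pos (p : PhaseParams d) : 0 < |p.t| := abs_pos.2 p.t_ne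

theorem size_pos (p : PhaseParams d) {ξ : EuclideanSpace ℝ (Fin d)} (hξ : ξ ≠ 0) :
    0 < p.size α ξ :=
  mul_pos p.abs_t_pos (Real.rpow_pos_of_pos (norm_pos_iff.2 hξ) _)

theorem size_eq_rpow (hα0 : α ≠ 0) (p : PhaseParams d) (ξ : EuclideanSpace ℝ (Fin d)) :
    p.size α ξ = (|p.t| ^ α⁻¹ * ‖ξ‖) ^ α := by
  rw [Real.mul_rpow (by positivity) (norm_nonneg _), Real.rpow_inv_rpow (abs_nonneg _) hα0]
  rfl

theorem one_le_weight (p : PhaseParams d) (ξ : EuclideanSpace ℝ (Fin d)) :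
    1 ≤ p.weight α φ ξ := by
  have : 0 ≤ ‖ξ‖ ^ (2 - α) / |p.t| * ∑ j, p.phaseGrad φ j ξ ^ 2 :=
    mul_nonneg (by positivity) (Finset.sum_nonneg fun _ _ => sq_nonneg _)
  unfold weight
  linarith

theorem weight_pos (p : PhaseParams d) (ξ : EuclideanSpace ℝ (Fin d)) :
    0 < p.weight α φ ξ := zero_lt_one.trans_le (p.one_le_weight ξ)

theorem rpow_two_sub_div (p : PhaseParams d) {ξ : EuclideanSpace ℝ (Fin d)} (hξ : ξ ≠ 0) :
    ‖ξ‖ ^ (2 - α) / |p.t| = ‖ξ‖ ^ 2 / p.size α ξ := by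
  have hξ' := norm_pos_iff.2 hξ
  rw [size, Real.rpow_sub hξ', Real.rpow_two, div_div, mul_comm]

theorem isOpen_lt_size (α c : ℝ) (p : PhaseParams d) :
    IsOpen {ξ | ξ ≠ 0 ∧ c < p.size α ξ} := by
  have h : ContinuousOn (fun ξ : EuclideanSpace ℝ (Fin d) => p.size α ξ) {0}ᶜ := fun ξ hξ =>
    (continuousAt_const.mul (continuous_norm.continuousAt.rpow_const
      (Or.inl (norm_ne_zero_iff.2 hξ)))).continuousWithinAt
  exact h.isOpen_inter_preimage isOpen_compl_singleton isOpen_Ioi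

variable (α c φ) in
/-- The frame adapted to the phase: on the region `s > c`, a derivative costs
`(1 + (s / w)^{1/2}) / |ξ|`. -/
noncomputable def oscFrame : SymbolFrame (PhaseParams d) d where
  U p := {ξ | ξ ≠ 0 ∧ c < p.size α ξ}
  isOpen p := p.isOpen_lt_size α c
  g p ξ := (1 + √(p.size α ξ) / √(p.weight α φ ξ)) / ‖ξ‖
  g_nonneg p ξ _ := by positivity

theorem isSymbol_of_punctured {k : ℕ}
    {M : PhaseParams d → EuclideanSpace ℝ (Fin d) → ℝ}
    {f : PhaseParams d → EuclideanSpace ℝ (Fin d) → ℂ}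
    (hf : (puncturedFrame (PhaseParams d) d).IsSymbol k M f)
    (hM : ∀ p, ∀ ξ, ξ ≠ 0 → 0 ≤ M p ξ) : (oscFrame α c φ).IsSymbol k M f := by
  refine hf.change_frame id (fun q ξ hξ => hξ.1) hM zero_le_one fun q ξ hξ => ?_
  rw [one_mul]
  simp only [puncturedFrame, oscFrame]
  rw [← one_div]
  gcongr
  have : 0 ≤ √(q.size α ξ) / √(q.weight α φ ξ) := by positivity
  linarith

variable {B lam d₁ d₂ : ℝ}

theorem abs_phaseGrad_le (j : Fin d) (p : PhaseParams d) {ξ : EuclideanSpace ℝ (Fin d)}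
    (hξ : ξ ≠ 0) :
    |p.phaseGrad φ j ξ| ≤ √(p.size α ξ) * √(p.weight α φ ξ) / ‖ξ‖ := by
  have hξ' := norm_pos_iff.2 hξ
  have hs := p.size_pos (α := α) hξ
  rw [← Real.sqrt_mul hs.le, le_div_iff₀ hξ', ← abs_of_pos hξ', ← abs_mul]
  apply Real.abs_le_sqrt
  have h1 : p.phaseGrad φ j ξ ^ 2 ≤ ∑ j, p.phaseGrad φ j ξ ^ 2 :=
    Finset.single_le_sum (f := fun j => p.phaseGrad φ j ξ ^ 2) (fun _ _ => sq_nonneg _)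
      (Finset.mem_univ j)
  rw [weight, p.rpow_two_sub_div hξ, mul_add, ← mul_assoc, mul_div_cancel₀ _ hs.ne', mul_pow,
    mul_comm]
  have := mul_le_mul_of_nonneg_left h1 (sq_nonneg ‖ξ‖)
  linarith

/-- The derivatives of `∂_jΦ` are those of `t ∂_jφ`, of size `s / |ξ|²`; since
`s ≤ (s w)^{1/2} (1 + (s / w)^{1/2})`, they obey the symbol bounds for the weight `(s w)^{1/2} / |ξ|`, however large
`x` is. -/
theorem isSymbol_phaseGrad (hφ : IsAlmostHomogeneousWith α B lam d₁ d₂ φ) (hB : 0 ≤ B) (j : Fin d) :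
    (oscFrame α c φ).IsSymbol d
      (fun p ξ => √(p.size α ξ) * √(p.weight α φ ξ) / ‖ξ‖)
      (fun p ξ => (p.phaseGrad φ j ξ : ℂ)) := by
  have hd : ∀ ξ, ξ ≠ 0 → DifferentiableAt ℝ (partialDeriv φ ![j]) ξ := fun ξ hξ =>
    (differentiableAt_and_fderiv_partialDeriv hφ.contDiffOn (by omega : 1 < d + 2) ![j] hξ).1
  refine IsSymbol.of_succ ⟨fun p ξ hξ => ?_, ⟨1, zero_le_one, fun p ξ hξ => ?_⟩, fun i => ?_⟩
  · exact (Complex.ofRealCLM.differentiableAt.comp ξ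
      (((hd ξ hξ.1).const_mul p.t).const_add (p.x j))).differentiableWithinAt
  · rw [one_mul, Complex.norm_real]
    exact p.abs_phaseGrad_le j hξ.1
  · have h1 : (puncturedFrame (PhaseParams d) d).IsSymbol d (fun p _ => |p.t|)
        (fun p _ => (p.t : ℂ)) :=
      IsSymbol.const zero_le_one (fun p ξ _ => by rw [one_mul, Complex.norm_real]; rfl)
        fun p ξ _ => abs_nonneg _
    have h2 := isSymbol_of_punctured (c := c) (φ := φ) (α := α) (h1.mul
      (hφ.isSymbol_partialDeriv hB (by omega) (Fin.cons i ![j] : Fin 2 → Fin d)))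
      fun p ξ _ => by positivity
    refine (h2.mono zero_le_one fun p ξ hξ => ?_).congr fun p ξ hξ => ?_
    · have hξ' := norm_pos_iff.2 hξ.1
      have hs := p.size_pos (α := α) hξ.1
      have hw := p.weight_pos (α := α) (φ := φ) ξ
      have e1 : |p.t| * ‖ξ‖ ^ (α - (2 : ℕ)) = p.size α ξ / ‖ξ‖ ^ 2 := by
        rw [size, Real.rpow_sub hξ', Real.rpow_natCast, mul_div_assoc]
      have e2 : √(p.size α ξ) * √(p.weight α φ ξ) / ‖ξ‖ *
          ((1 + √(p.size α ξ) / √(p.weight α φ ξ)) / ‖ξ‖) =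
          (√(p.size α ξ) * √(p.weight α φ ξ) + p.size α ξ) / ‖ξ‖ ^ 2 := by
        have hw' := Real.sqrt_pos.2 hw
        field_simp
        rw [mul_add, Real.mul_self_sqrt hs.le]
      rw [one_mul]
      simp only [oscFrame]
      rw [e1, e2]
      gcongr
      have : 0 ≤ √(p.size α ξ) * √(p.weight α φ ξ) := by positivity
      linarith
    · have := differentiableAt_and_fderiv_partialDeriv hφ.contDiffOn (by omega : 1 < d + 2)
        ![j] hξ.1
      have h3 : HasFDerivAt (fun ξ => p.phaseGrad φ j ξ)
          (p.t • fderiv ℝ (partialDeriv φ ![j]) ξ) ξ :=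
        (this.1.hasFDerivAt.const_mul p.t).const_add (p.x j)
      rw [coordDeriv_ofReal (h := fun p ξ => p.phaseGrad φ j ξ) (p := p) h3.differentiableAt i,
        h3.fderiv, smul_apply, this.2 i, smul_eq_mul]
      push_cast
      rfl

theorem isSymbol_norm_rpow_div_abs_t {k : ℕ} : (oscFrame α c φ).IsSymbol k
    (fun p ξ => ‖ξ‖ ^ (2 - α) / |p.t|) (fun p ξ => ((‖ξ‖ ^ (2 - α) / |p.t| : ℝ) : ℂ)) := by
  have h1 : (puncturedFrame (PhaseParams d) d).IsSymbol k (fun p _ => |p.t|⁻¹)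
      (fun p _ => ((|p.t|⁻¹ : ℝ) : ℂ)) :=
    IsSymbol.const zero_le_one
      (fun p ξ _ => by rw [one_mul, Complex.norm_real, Real.norm_of_nonneg (by positivity)])
      fun p ξ _ => by positivity
  refine (isSymbol_of_punctured ((isSymbol_norm_rpow (2 - α)).mul h1)
    fun p ξ _ => by positivity).congr fun p ξ _ => ?_
  push_cast
  rfl

theorem isSymbol_weight (hφ : IsAlmostHomogeneousWith α B lam d₁ d₂ φ) (hB : 0 ≤ B) :
    (oscFrame α c φ).IsSymbol d (fun p ξ => p.weight α φ ξ)
      (fun p ξ => (p.weight α φ ξ : ℂ)) := by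
  have h1 : (oscFrame α c φ).IsSymbol d (fun p ξ => p.weight α φ ξ) (fun _ _ => 1) :=
    IsSymbol.const zero_le_one (fun p ξ _ => by simpa using p.one_le_weight ξ)
      fun p ξ _ => (p.weight_pos ξ).le
  have h2 := IsSymbol.sum Finset.univ (F := oscFrame α c φ) (k := d)
    (M := fun p ξ => (√(p.size α ξ) * √(p.weight α φ ξ) / ‖ξ‖) *
      (√(p.size α ξ) * √(p.weight α φ ξ) / ‖ξ‖))
    (f := fun j p ξ => (p.phaseGrad φ j ξ : ℂ) * (p.phaseGrad φ j ξ : ℂ))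
    (fun p ξ _ => by positivity)
    fun j _ => (isSymbol_phaseGrad hφ hB j).mul (isSymbol_phaseGrad hφ hB j)
  refine (h1.add ((isSymbol_norm_rpow_div_abs_t.mul h2).weight_congr fun p ξ hξ => ?_)).congr
    fun p ξ hξ => ?_
  · have hξ' := norm_pos_iff.2 hξ.1
    have hs := p.size_pos (α := α) hξ.1
    have hw := p.weight_pos (α := α) (φ := φ) ξ
    rw [p.rpow_two_sub_div hξ.1]
    field_simp
    rw [Real.sq_sqrt hs.le, Real.sq_sqrt hw.le]
  · rw [weight]
    push_cast
    simp only [sq]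

variable (α φ) in
/-- The components `(|ξ|² / s) ∂_jΦ / w` of the vector field along which one integrates by parts.
-/
noncomputable def field (j : Fin d) (p : PhaseParams d) (ξ : EuclideanSpace ℝ (Fin d)) : ℂ :=
  (p.phaseGrad φ j ξ : ℂ) * (((‖ξ‖ ^ (2 - α) / |p.t| : ℝ) : ℂ) * (p.weight α φ ξ : ℂ)⁻¹)

theorem isSymbol_weight_inv (hφ : IsAlmostHomogeneousWith α B lam d₁ d₂ φ) (hB : 0 ≤ B) :
    (oscFrame α c φ).IsSymbol d (fun p ξ => (p.weight α φ ξ)⁻¹)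
      (fun p ξ => (p.weight α φ ξ : ℂ)⁻¹) :=
  (isSymbol_weight hφ hB).inv (fun p ξ _ => p.weight_pos ξ) one_pos fun p ξ _ => by
    rw [one_mul, Complex.norm_real]; exact le_abs_self _

theorem isSymbol_field (hφ : IsAlmostHomogeneousWith α B lam d₁ d₂ φ) (hB : 0 ≤ B) (j : Fin d) :
    (oscFrame α c φ).IsSymbol d (fun p ξ => ‖ξ‖ / (√(p.size α ξ) * √(p.weight α φ ξ)))
      (field α φ j) := by
  refine ((isSymbol_phaseGrad hφ hB j).mul
    (isSymbol_norm_rpow_div_abs_t.mul (isSymbol_weight_inv hφ hB))).weight_congr fun p ξ hξ => ?_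
  have hξ' := norm_pos_iff.2 hξ.1
  have hs := p.size_pos (α := α) hξ.1
  have hw := p.weight_pos (α := α) (φ := φ) ξ
  rw [p.rpow_two_sub_div hξ.1]
  have e1 : ∀ a : ℝ, √a * √a = a → 0 < √a → √a / a = (√a)⁻¹ := fun a ha h => by
    nth_rw 2 [← ha]
    field_simp
  have hs' := Real.sqrt_pos.2 hs
  have hw' := Real.sqrt_pos.2 hw
  calc _ = ‖ξ‖ * (√(p.size α ξ) / p.size α ξ) * (√(p.weight α φ ξ) / p.weight α φ ξ) := by
        field_simp
    _ = _ := by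
        rw [e1 _ (Real.mul_self_sqrt hs.le) hs', e1 _ (Real.mul_self_sqrt hw.le) hw']
        field_simp

variable (α φ) in
/-- The transpose `f ↦ f / w + i ∑ⱼ ∂ⱼ(Vⱼ f)` of the operator `w⁻¹ - i V·∇`, which fixes `e^{iΦ}`.
Here `V` is the vector field `PhaseParams.field`. -/
noncomputable def transposeOp (f : PhaseParams d → EuclideanSpace ℝ (Fin d) → ℂ)
    (p : PhaseParams d) (ξ : EuclideanSpace ℝ (Fin d)) : ℂ :=
  f p ξ * (p.weight α φ ξ : ℂ)⁻¹ +
    Complex.I * ∑ j, coordDeriv j (fun p ξ => field α φ j p ξ * f p ξ) p ξ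

variable (α φ) in
/-- The factor `w⁻¹ + (s w)^{-1/2}` gained by one integration by parts. -/
noncomputable def gain (p : PhaseParams d) (ξ : EuclideanSpace ℝ (Fin d)) : ℝ :=
  (p.weight α φ ξ)⁻¹ + (√(p.size α ξ) * √(p.weight α φ ξ))⁻¹

theorem gain_nonneg (p : PhaseParams d) (ξ : EuclideanSpace ℝ (Fin d)) : 0 ≤ p.gain α φ ξ := by
  have := p.weight_pos (α := α) (φ := φ) ξ
  unfold gain
  positivity

variable {k : ℕ} {M : PhaseParams d → EuclideanSpace ℝ (Fin d) → ℝ}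
  {f : PhaseParams d → EuclideanSpace ℝ (Fin d) → ℂ}

theorem isSymbol_field_mul (hφ : IsAlmostHomogeneousWith α B lam d₁ d₂ φ) (hB : 0 ≤ B)
    (hf : (oscFrame α c φ).IsSymbol k M f) (hk : k ≤ d) (j : Fin d) :
    (oscFrame α c φ).IsSymbol k
      (fun p ξ => ‖ξ‖ / (√(p.size α ξ) * √(p.weight α φ ξ)) * M p ξ)
      (fun p ξ => field α φ j p ξ * f p ξ) :=
  ((isSymbol_field hφ hB j).of_le hk).mul hf

/-- One use of the transpose gains the factor `w⁻¹ + (s w)^{-1/2}`, which is the size of `V` times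
the cost of a derivative. -/
theorem isSymbol_transposeOp (hφ : IsAlmostHomogeneousWith α B lam d₁ d₂ φ) (hB : 0 ≤ B)
    (hM : ∀ p, ∀ ξ, 0 ≤ M p ξ)
    (hf : (oscFrame α c φ).IsSymbol (k + 1) M f) (hk : k + 1 ≤ d) :
    (oscFrame α c φ).IsSymbol k (fun p ξ => M p ξ * p.gain α φ ξ) (transposeOp α φ f) := by
  refine IsSymbol.add ?_ (IsSymbol.const_mul (IsSymbol.sum _
    (fun p ξ _ => mul_nonneg (hM p ξ) (p.gain_nonneg ξ)) fun j _ => ?_) _)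
  · refine (hf.of_succ.mul ((isSymbol_weight_inv hφ hB).of_le (by omega))).mono zero_le_one
      fun p ξ _ => ?_
    rw [one_mul]
    refine mul_le_mul_of_nonneg_left ?_ (hM p ξ)
    have : 0 ≤ (√(p.size α ξ) * √(p.weight α φ ξ))⁻¹ := by positivity
    unfold gain
    linarith
  · refine ((isSymbol_field_mul hφ hB hf hk j).coordDeriv j).weight_congr fun p ξ hξ => ?_
    have hξ' := norm_pos_iff.2 hξ.1
    have hs' := Real.sqrt_pos.2 (p.size_pos (α := α) hξ.1)
    have hw := p.weight_pos (α := α) (φ := φ) ξ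
    have hw' := Real.sqrt_pos.2 hw
    simp only [oscFrame, gain]
    have : (p.weight α φ ξ)⁻¹ = (√(p.weight α φ ξ) * √(p.weight α φ ξ))⁻¹ := by
      rw [Real.mul_self_sqrt hw.le]
    rw [this]
    field_simp
    ring

theorem transposeOp_eq_zero {K : Set (EuclideanSpace ℝ (Fin d))} (hK : IsClosed K)
    {p : PhaseParams d} (hf : ∀ ξ ∉ K, f p ξ = 0) : ∀ ξ ∉ K, transposeOp α φ f p ξ = 0 := by
  intro ξ hξ
  have h : ∀ j, (fun ξ => field α φ j p ξ * f p ξ) =ᶠ[nhds ξ] fun _ => 0 := fun j => by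
    filter_upwards [hK.isOpen_compl.mem_nhds hξ] with η hη
    rw [hf η hη, mul_zero]
  simp only [transposeOp, coordDeriv, (h _).fderiv_eq, hf ξ hξ]
  simp

theorem differentiableAt_and_fderiv_phaseExp
    (hφ : IsAlmostHomogeneousWith α B lam d₁ d₂ φ) (p : PhaseParams d)
    {ξ : EuclideanSpace ℝ (Fin d)} (hξ : ξ ≠ 0) :
    DifferentiableAt ℝ (p.phaseExp φ) ξ ∧ ∀ j, fderiv ℝ (p.phaseExp φ) ξ
      (EuclideanSpace.single j (1 : ℝ)) =
        p.phaseExp φ ξ * (Complex.I * (p.phaseGrad φ j ξ : ℂ)) := by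
  have hat : DifferentiableAt ℝ φ ξ :=
    (hφ.contDiffOn.contDiffAt (isOpen_compl_singleton.mem_nhds hξ)).differentiableAt (by simp)
  have h1 : HasFDerivAt (fun ξ => inner ℝ p.x ξ + p.t * φ ξ)
      (innerSL ℝ p.x + p.t • fderiv ℝ φ ξ) ξ :=
    ((innerSL ℝ p.x).hasFDerivAt).add (hat.hasFDerivAt.const_mul p.t)
  have h2 := ((Complex.ofRealCLM.hasFDerivAt.comp ξ h1).const_mul Complex.I).cexp
  refine ⟨h2.differentiableAt, fun j => ?_⟩
  have h3 := h2.fderiv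
  change fderiv ℝ (p.phaseExp φ) ξ = _ at h3
  rw [h3, phaseGrad, partialDeriv_one]
  simp [phaseExp, EuclideanSpace.inner_single_right]
  ring

theorem integrable_of_continuousOn {U K : Set (EuclideanSpace ℝ (Fin d))} (hK : IsCompact K)
    (hKU : K ⊆ U) {u : EuclideanSpace ℝ (Fin d) → ℂ} (hu : ContinuousOn u U)
    (h0 : ∀ ξ ∉ K, u ξ = 0) : Integrable u := by
  refine (integrableOn_iff_integrable_of_support_subset fun ξ hξ => ?_).1
    ((hu.mono hKU).integrableOn_compact hK)
  by_contra h
  exact hξ (h0 ξ h)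

theorem integral_fderiv_eq_zero {u : EuclideanSpace ℝ (Fin d) → ℂ} (v : EuclideanSpace ℝ (Fin d))
    (hu : Differentiable ℝ u) (hi : Integrable u) (hi' : Integrable fun ξ => fderiv ℝ u ξ v) :
    ∫ ξ, fderiv ℝ u ξ v = 0 := by
  have := integral_mul_fderiv_eq_neg_fderiv_mul_of_integrable (μ := volume) (𝕜 := ℂ)
    (f := fun _ : EuclideanSpace ℝ (Fin d) => (1 : ℂ)) (g := u) (v := v) (by simp)
    (by simpa using hi') (by simpa using hi) (fun _ _ => differentiableAt_const _) fun _ _ => hu _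
  simpa using this

/-- Integration by parts: the difference of the two integrands is a divergence, of the compactly
supported field `e^{iΦ} V f`. -/
theorem integral_transposeOp (hφ : IsAlmostHomogeneousWith α B lam d₁ d₂ φ) (hB : 0 ≤ B)
    (hd : 1 ≤ d) (hf : (oscFrame α c φ).IsSymbol 1 M f)
    {p : PhaseParams d} {K : Set (EuclideanSpace ℝ (Fin d))} (hK : IsCompact K)
    (hKU : K ⊆ (oscFrame α c φ).U p) (h0 : ∀ ξ ∉ K, f p ξ = 0) :
    ∫ ξ, p.phaseExp φ ξ * f p ξ = ∫ ξ, p.phaseExp φ ξ * transposeOp α φ f p ξ := by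
  set U := (oscFrame α c φ).U p with hU
  have hUo : IsOpen U := (oscFrame α c φ).isOpen p
  have he : ∀ ξ ∈ U, DifferentiableAt ℝ (p.phaseExp φ) ξ := fun ξ hξ =>
    (differentiableAt_and_fderiv_phaseExp hφ p hξ.1).1
  have hec : ContinuousOn (p.phaseExp φ) U := fun ξ hξ => (he ξ hξ).continuousAt.continuousWithinAt
  have hV := isSymbol_field_mul hφ hB hf hd
  have hwinv := (isSymbol_weight_inv (c := c) hφ hB).continuousOn p
  have hqc := fun j => (isSymbol_phaseGrad (c := c) hφ hB j).continuousOn p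
  have hV0 : ∀ j, ∀ ξ ∉ K, field α φ j p ξ * f p ξ = 0 := fun j ξ hξ => by rw [h0 ξ hξ, mul_zero]
  let u : Fin d → EuclideanSpace ℝ (Fin d) → ℂ := fun j ξ =>
    p.phaseExp φ ξ * (field α φ j p ξ * f p ξ)
  have hu0 : ∀ j, ∀ ξ ∉ K, u j ξ = 0 := fun j ξ hξ => by simp only [u, hV0 j ξ hξ, mul_zero]
  have hueq : ∀ j, ∀ ξ ∉ K, u j =ᶠ[nhds ξ] fun _ => 0 := fun j ξ hξ => by
    filter_upwards [hK.isClosed.isOpen_compl.mem_nhds hξ] with η hη using hu0 j η hη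
  have hVeq : ∀ j, ∀ ξ ∉ K, (fun ξ => field α φ j p ξ * f p ξ) =ᶠ[nhds ξ] fun _ => 0 :=
    fun j ξ hξ => by
      filter_upwards [hK.isClosed.isOpen_compl.mem_nhds hξ] with η hη using hV0 j η hη
  have hud : ∀ j, Differentiable ℝ (u j) := fun j ξ => by
    by_cases hξ : ξ ∈ K
    · exact (he ξ (hKU hξ)).mul ((hV j).differentiableAt (hKU hξ))
    · exact (hueq j ξ hξ).differentiableAt_iff.2 (differentiableAt_const _)
  have hufd : ∀ j ξ, fderiv ℝ (u j) ξ (EuclideanSpace.single j (1 : ℝ)) =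
      p.phaseExp φ ξ * (Complex.I * (p.phaseGrad φ j ξ : ℂ) * (field α φ j p ξ * f p ξ) +
        coordDeriv j (fun p ξ => field α φ j p ξ * f p ξ) p ξ) := fun j ξ => by
    by_cases hξ : ξ ∈ K
    · have := fderiv_fun_mul (he ξ (hKU hξ)) ((hV j).differentiableAt (hKU hξ))
      simp only [u]
      rw [this]
      simp only [add_apply, smul_apply, smul_eq_mul,
        (differentiableAt_and_fderiv_phaseExp hφ p (hKU hξ).1).2 j,
        coordDeriv]
      ring
    · rw [(hueq j ξ hξ).fderiv_eq, coordDeriv, (hVeq j ξ hξ).fderiv_eq, hV0 j ξ hξ]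
      simp
  have hui : ∀ j, Integrable (u j) := fun j =>
    integrable_of_continuousOn hK hKU (hec.mul ((hV j).continuousOn p)) (hu0 j)
  have hui' : ∀ j, Integrable fun ξ => fderiv ℝ (u j) ξ (EuclideanSpace.single j (1 : ℝ)) := by
    intro j
    refine integrable_of_continuousOn hK hKU ?_ fun ξ hξ => by
      rw [(hueq j ξ hξ).fderiv_eq]; simp
    simp only [hufd]
    exact hec.mul (((continuousOn_const.mul (hqc j)).mul ((hV j).continuousOn p)).add
      (((hV j).coordDeriv j).continuousOn p))
  have hTi : Integrable fun ξ => p.phaseExp φ ξ * transposeOp α φ f p ξ := by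
    refine integrable_of_continuousOn hK hKU (hec.mul (((hf.continuousOn p).mul hwinv).add
      (continuousOn_const.mul (continuousOn_finsetSum _ fun j _ =>
        ((hV j).coordDeriv j).continuousOn p)))) fun ξ hξ => ?_
    rw [transposeOp_eq_zero hK.isClosed h0 ξ hξ, mul_zero]
  -- `w⁻¹ + ∑ⱼ Vⱼ ∂ⱼΦ = 1`, so `e^{iΦ} f` and `e^{iΦ} Tf` differ by a divergence
  have key : ∀ ξ, p.phaseExp φ ξ * f p ξ = p.phaseExp φ ξ * transposeOp α φ f p ξ +
      -Complex.I * ∑ j, fderiv ℝ (u j) ξ (EuclideanSpace.single j (1 : ℝ)) := fun ξ => by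
    simp only [hufd, ← Finset.mul_sum, Finset.sum_add_distrib]
    have h1 : ∑ j, Complex.I * (p.phaseGrad φ j ξ : ℂ) * (field α φ j p ξ * f p ξ) =
        Complex.I * f p ξ * (1 - (p.weight α φ ξ : ℂ)⁻¹) := by
      have hw : (p.weight α φ ξ : ℂ) ≠ 0 := by exact_mod_cast (p.weight_pos ξ).ne'
      have h2 : (1 - (p.weight α φ ξ : ℂ)⁻¹) =
          ((‖ξ‖ ^ (2 - α) / |p.t| : ℝ) : ℂ) * (∑ j, (p.phaseGrad φ j ξ : ℂ) ^ 2) *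
            (p.weight α φ ξ : ℂ)⁻¹ := by
        have : (p.weight α φ ξ : ℂ) = 1 +
          ((‖ξ‖ ^ (2 - α) / |p.t| : ℝ) : ℂ) * (∑ j, (p.phaseGrad φ j ξ : ℂ) ^ 2) := by
            rw [weight]; push_cast; rfl
        field_simp
        rw [this]
        ring
      rw [h2, Finset.mul_sum, Finset.sum_mul, Finset.mul_sum]
      refine Finset.sum_congr rfl fun j _ => ?_
      simp only [field]
      ring
    rw [h1, transposeOp]
    ring_nf
    rw [Complex.I_sq]
    ring
  simp only [key]
  rw [integral_add hTi ((integrable_finsetSum _ fun j _ => hui' j).const_mul _),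
    integral_const_mul, integral_finsetSum _ fun j _ => hui' j,
    Finset.sum_eq_zero fun j _ => integral_fderiv_eq_zero _ (hud j) (hui j) (hui' j)]
  simp

/-- Replacing a compactly supported symbol `f` of weight `M` by its image under `n` uses of the
transpose: the oscillatory integral does not change, and the new amplitude is `O(M ρ^n)`, where
`ρ` is the gain. -/
theorem exists_integral_eq_of_isSymbol (hφ : IsAlmostHomogeneousWith α B lam d₁ d₂ φ)
    (hB : 0 ≤ B) {n : ℕ} (hn : n ≤ d) (hM : ∀ p, ∀ ξ, 0 ≤ M p ξ)
    (hf : (oscFrame α c φ).IsSymbol n M f) :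
    ∃ C, 0 ≤ C ∧ ∀ (p : PhaseParams d) (K : Set (EuclideanSpace ℝ (Fin d))), IsCompact K →
      K ⊆ (oscFrame α c φ).U p → (∀ ξ ∉ K, f p ξ = 0) →
      ∃ b : EuclideanSpace ℝ (Fin d) → ℂ, (∀ ξ ∉ K, b ξ = 0) ∧
        (∀ ξ ∈ K, ‖b ξ‖ ≤ C * (M p ξ * p.gain α φ ξ ^ n)) ∧
        ∫ ξ, p.phaseExp φ ξ * f p ξ = ∫ ξ, p.phaseExp φ ξ * b ξ := by
  induction n generalizing M f with
  | zero =>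
    obtain ⟨C, hC, H⟩ := hf.boundedBy
    exact ⟨C, hC, fun p K _ hKU h0 =>
      ⟨f p, h0, fun ξ hξ => by simpa using H p ξ (hKU hξ), rfl⟩⟩
  | succ n ih =>
    obtain ⟨C, hC, H⟩ := ih (by omega) (fun p ξ => mul_nonneg (hM p ξ) (p.gain_nonneg ξ))
      (isSymbol_transposeOp hφ hB hM hf hn)
    refine ⟨C, hC, fun p K hK hKU h0 => ?_⟩
    obtain ⟨b, hb0, hb, hbi⟩ := H p K hK hKU (transposeOp_eq_zero hK.isClosed h0)
    refine ⟨b, hb0, fun ξ hξ => (hb ξ hξ).trans_eq (by ring), ?_⟩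
    rw [← hbi]
    exact integral_transposeOp hφ hB (by omega) (hf.of_le (by omega)) hK hKU h0

end PhaseParams

/-! ### Integrals of powers of the norm -/

section Integrals

variable {d : ℕ}

theorem lintegral_comp_smul_of_pos (f : EuclideanSpace ℝ (Fin d) → ENNReal) {ρ : ℝ} (hρ : 0 < ρ) :
    ∫⁻ ξ, f (ρ • ξ) = ENNReal.ofReal (ρ ^ (-(d : ℝ))) * ∫⁻ ξ, f ξ := by
  have h1 := (Homeomorph.smulOfNeZero ρ hρ.ne'
    (α := EuclideanSpace ℝ (Fin d))).measurableEmbedding.lintegral_map (μ := volume) f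
  have h2 := Measure.map_addHaar_smul (volume : Measure (EuclideanSpace ℝ (Fin d))) hρ.ne'
  have h3 : Measure.map (Homeomorph.smulOfNeZero ρ hρ.ne' (α := EuclideanSpace ℝ (Fin d))) volume =
      Measure.map (ρ • ·) (volume : Measure (EuclideanSpace ℝ (Fin d))) := rfl
  rw [h3, h2, lintegral_smul_measure] at h1
  simp only [Homeomorph.smulOfNeZero_apply] at h1
  rw [← h1, finrank_euclideanSpace_fin, abs_of_pos (by positivity), Real.rpow_neg hρ.le,
    Real.rpow_natCast, smul_eq_mul]

/-- Scaling of the integral of a power of the norm over a dilated set. -/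
theorem setLIntegral_norm_rpow_dilate {S : Set (EuclideanSpace ℝ (Fin d))} (hS : MeasurableSet S)
    (δ : ℝ) {ρ : ℝ} (hρ : 0 < ρ) :
    ∫⁻ ξ in {ξ | ρ • ξ ∈ S}, ENNReal.ofReal (‖ξ‖ ^ δ) =
      ENNReal.ofReal (ρ ^ (-d - δ : ℝ)) * ∫⁻ ξ in S, ENNReal.ofReal (‖ξ‖ ^ δ) := by
  have hS' : MeasurableSet {ξ : EuclideanSpace ℝ (Fin d) | ρ • ξ ∈ S} :=
    (measurable_const_smul ρ) hS
  have h := lintegral_comp_smul_of_pos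
    (S.indicator fun ξ : EuclideanSpace ℝ (Fin d) => ENNReal.ofReal (‖ξ‖ ^ δ)) hρ
  rw [lintegral_indicator hS] at h
  rw [sub_eq_add_neg, Real.rpow_add hρ, mul_comm (ρ ^ (-(d : ℝ))),
    ENNReal.ofReal_mul (by positivity), mul_assoc, ← h, ← lintegral_const_mul' _ _ ENNReal.ofReal_ne_top, ← lintegral_indicator hS']
  congr 1
  ext ξ
  by_cases hξ : ρ • ξ ∈ S
  · rw [Set.indicator_of_mem (show ξ ∈ {ξ | ρ • ξ ∈ S} from hξ), Set.indicator_of_mem hξ,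
      ← ENNReal.ofReal_mul (by positivity), norm_smul, Real.norm_of_nonneg hρ.le,
      Real.mul_rpow hρ.le (norm_nonneg _), ← mul_assoc, ← Real.rpow_add hρ]
    simp
  · rw [Set.indicator_of_notMem (show ξ ∉ {ξ | ρ • ξ ∈ S} from hξ), Set.indicator_of_notMem hξ,
      mul_zero]

theorem integrableOn_ball_norm_rpow (hd : 1 ≤ d) {δ : ℝ} (hδ : -d < δ) (r : ℝ) :
    IntegrableOn (fun ξ : EuclideanSpace ℝ (Fin d) => ‖ξ‖ ^ δ) (Metric.ball 0 r) := by
  have : Nonempty (Fin d) := ⟨⟨0, hd⟩⟩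
  rcases le_or_gt r 0 with hr | hr
  · rw [Metric.ball_eq_empty.2 hr]; simp
  rw [integrableOn_fun_norm_addHaar volume (f := fun y => y ^ δ), finrank_euclideanSpace_fin]
  have h := (intervalIntegral.integrableOn_Ioo_rpow_iff (s := (d : ℝ) - 1 + δ) hr).2 (by linarith)
  refine h.congr_fun (fun y hy => ?_) measurableSet_Ioo
  have h1 : y ^ (d - 1) = y ^ ((d : ℝ) - 1) := by
    rw [← Real.rpow_natCast, Nat.cast_sub hd, Nat.cast_one]
  simp only
  rw [smul_eq_mul, h1, ← Real.rpow_add hy.1]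

theorem integrableOn_compl_ball_norm_rpow (hd : 1 ≤ d) {δ : ℝ} (hδ : δ < -d) {r : ℝ} (hr : 0 < r) :
    IntegrableOn (fun ξ : EuclideanSpace ℝ (Fin d) => ‖ξ‖ ^ δ) {ξ | r ≤ ‖ξ‖} := by
  have : Nonempty (Fin d) := ⟨⟨0, hd⟩⟩
  have hm : MeasurableSet {ξ : EuclideanSpace ℝ (Fin d) | r ≤ ‖ξ‖} :=
    measurableSet_le measurable_const measurable_norm
  rw [← integrable_indicator_iff hm]
  have h0 : ({ξ : EuclideanSpace ℝ (Fin d) | r ≤ ‖ξ‖}.indicator fun ξ => ‖ξ‖ ^ δ) =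
      fun ξ => (Set.Ici r).indicator (fun y => y ^ δ) ‖ξ‖ := by
    ext ξ
    simp [Set.indicator]
  rw [h0, integrable_fun_norm_addHaar volume, finrank_euclideanSpace_fin]
  have h := integrableOn_Ioi_rpow_of_lt (a := (d : ℝ) - 1 + δ) (by linarith) hr
  rw [← integrableOn_Ici_iff_integrableOn_Ioi, ← integrable_indicator_iff measurableSet_Ici] at h
  refine h.integrableOn.congr_fun (fun y hy => ?_) measurableSet_Ioi
  have h1 : y ^ (d - 1) = y ^ ((d : ℝ) - 1) := by
    rw [← Real.rpow_natCast, Nat.cast_sub hd, Nat.cast_one]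
  simp only [Set.indicator]
  split_ifs with hy'
  · rw [smul_eq_mul, h1, ← Real.rpow_add hy]
  · simp

theorem exists_setLIntegral_norm_rpow_dilate {S : Set (EuclideanSpace ℝ (Fin d))}
    (hS : MeasurableSet S) {δ : ℝ} (hi : IntegrableOn (fun ξ => ‖ξ‖ ^ δ) S) :
    ∃ C, 0 ≤ C ∧ ∀ ρ : ℝ, 0 < ρ → ∫⁻ ξ in {ξ | ρ • ξ ∈ S}, ENNReal.ofReal (‖ξ‖ ^ δ) ≤
      ENNReal.ofReal (C * ρ ^ (-d - δ : ℝ)) := by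
  have hfin : ∫⁻ ξ in S, ENNReal.ofReal (‖ξ‖ ^ δ) ≠ ⊤ := hi.lintegral_lt_top.ne
  refine ⟨_, ENNReal.toReal_nonneg (a := ∫⁻ ξ in S, ENNReal.ofReal (‖ξ‖ ^ δ)), fun ρ hρ => ?_⟩
  rw [setLIntegral_norm_rpow_dilate hS δ hρ, ENNReal.ofReal_mul ENNReal.toReal_nonneg,
    ENNReal.ofReal_toReal hfin, mul_comm]

theorem exists_setLIntegral_norm_rpow_le (hd : 1 ≤ d) {δ : ℝ} (hδ : -d < δ) (r : ℝ) :
    ∃ C, 0 ≤ C ∧ ∀ ρ : ℝ, 0 < ρ → ∫⁻ ξ in {ξ : EuclideanSpace ℝ (Fin d) | ρ * ‖ξ‖ ≤ r},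
      ENNReal.ofReal (‖ξ‖ ^ δ) ≤ ENNReal.ofReal (C * ρ ^ (-d - δ : ℝ)) := by
  obtain ⟨C, hC, H⟩ := exists_setLIntegral_norm_rpow_dilate Metric.isClosed_closedBall.measurableSet
    ((integrableOn_ball_norm_rpow hd hδ (r + 1)).mono_set
      (Metric.closedBall_subset_ball (by linarith : r < r + 1)))
  refine ⟨C, hC, fun ρ hρ => ?_⟩
  have := H ρ hρ
  simpa [norm_smul, abs_of_pos hρ] using this

theorem exists_setLIntegral_norm_rpow_ge (hd : 1 ≤ d) {δ : ℝ} (hδ : δ < -d) {r : ℝ} (hr : 0 < r) :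
    ∃ C, 0 ≤ C ∧ ∀ ρ : ℝ, 0 < ρ → ∫⁻ ξ in {ξ : EuclideanSpace ℝ (Fin d) | r ≤ ρ * ‖ξ‖},
      ENNReal.ofReal (‖ξ‖ ^ δ) ≤ ENNReal.ofReal (C * ρ ^ (-d - δ : ℝ)) := by
  obtain ⟨C, hC, H⟩ := exists_setLIntegral_norm_rpow_dilate
    (measurableSet_le measurable_const measurable_norm)
    (integrableOn_compl_ball_norm_rpow hd hδ hr)
  refine ⟨C, hC, fun ρ hρ => ?_⟩
  have := H ρ hρ
  simpa [norm_smul, abs_of_pos hρ] using this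

/-- The integral of `(1 + μ²|ξ - ξ₀|²)^{-d}` is `O(μ^{-d})`, since `2d > d`. -/
theorem exists_lintegral_inv_one_add_sq_pow_le (hd : 1 ≤ d) :
    ∃ C, 0 ≤ C ∧ ∀ (μ : ℝ) (ξ₀ : EuclideanSpace ℝ (Fin d)), 0 < μ →
      ∫⁻ ξ, ENNReal.ofReal (((1 + (μ * ‖ξ - ξ₀‖) ^ 2) ^ d)⁻¹) ≤
        ENNReal.ofReal (C * μ ^ (-(d : ℝ))) := by
  have hi := integrable_rpow_neg_one_add_norm_sq (E := EuclideanSpace ℝ (Fin d)) (μ := volume)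
    (r := 2 * d) (by
      rw [finrank_euclideanSpace_fin]
      have : (1 : ℝ) ≤ d := by exact_mod_cast hd
      linarith)
  have hfin := hi.lintegral_lt_top.ne
  refine ⟨_, ENNReal.toReal_nonneg (a := ∫⁻ ξ : EuclideanSpace ℝ (Fin d),
    ENNReal.ofReal ((1 + ‖ξ‖ ^ 2) ^ (-(2 * d : ℝ) / 2))), fun μ ξ₀ hμ => ?_⟩
  rw [ENNReal.ofReal_mul ENNReal.toReal_nonneg, ENNReal.ofReal_toReal hfin, mul_comm,
    ← lintegral_comp_smul_of_pos _ hμ]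
  rw [lintegral_sub_right_eq_self
    (fun ξ : EuclideanSpace ℝ (Fin d) => ENNReal.ofReal (((1 + (μ * ‖ξ‖) ^ 2) ^ d)⁻¹))]
  refine le_of_eq (lintegral_congr fun ξ => ?_)
  congr 1
  rw [norm_smul, Real.norm_of_nonneg hμ.le, neg_div, Real.rpow_neg (by positivity),
    mul_div_cancel_left₀ _ (two_ne_zero), Real.rpow_natCast]

end Integrals

/-! ### Quantitative local injectivity of the gradient -/

section Geometry

/-- Powers of either sign of comparable positive numbers are comparable. -/
theorem Real.rpow_le_mul_rpow_of_comparable {a b K : ℝ} (ha : 0 < a) (hb : 0 < b) (hK : 0 < K)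
    (hab : a ≤ K * b) (hba : b ≤ K * a) (β : ℝ) : a ^ β ≤ K ^ |β| * b ^ β := by
  rcases le_total 0 β with h | h
  · rw [abs_of_nonneg h, ← Real.mul_rpow hK.le hb.le]
    exact Real.rpow_le_rpow ha.le hab h
  · have h1 : b / K ≤ a := by rw [div_le_iff₀ hK]; linarith
    have := Real.rpow_le_rpow_of_nonpos (by positivity) h1 h
    rwa [Real.div_rpow hb.le hK.le, div_eq_mul_inv, ← Real.rpow_neg hK.le, mul_comm,
      ← abs_of_nonpos h] at this

variable {d : ℕ} {α B lam d₁ d₂ : ℝ} {φ : EuclideanSpace ℝ (Fin d) → ℝ}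

theorem gradient_apply (φ : EuclideanSpace ℝ (Fin d) → ℝ) (ξ : EuclideanSpace ℝ (Fin d))
    (j : Fin d) : gradient φ ξ j = partialDeriv φ ![j] ξ := by
  rw [partialDeriv_one]
  have := InnerProductSpace.toDual_symm_apply (𝕜 := ℝ) (x := EuclideanSpace.single j (1 : ℝ))
    (y := fderiv ℝ φ ξ)
  rw [← this, EuclideanSpace.inner_single_right]
  simp [gradient]

theorem EuclideanSpace.eq_sum_smul_single (v : EuclideanSpace ℝ (Fin d)) :
    v = ∑ j, v j • EuclideanSpace.single j (1 : ℝ) := by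
  ext i
  simp [Finset.sum_apply, Pi.single_apply]

theorem EuclideanSpace.opNorm_le_of_single {L : EuclideanSpace ℝ (Fin d) →L[ℝ] ℝ} {b : ℝ}
    (hb : ∀ j, |L (EuclideanSpace.single j (1 : ℝ))| ≤ b) (hb0 : 0 ≤ b) : ‖L‖ ≤ d * b := by
  refine L.opNorm_le_bound (by positivity) fun v => ?_
  conv_lhs => rw [EuclideanSpace.eq_sum_smul_single v, map_sum]
  refine (norm_sum_le _ _).trans ?_
  calc ∑ j, ‖L (v j • EuclideanSpace.single j (1 : ℝ))‖ ≤ ∑ _j : Fin d, b * ‖v‖ := by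
        refine Finset.sum_le_sum fun j _ => ?_
        rw [map_smul, norm_smul, mul_comm]
        exact mul_le_mul (hb j) (EuclideanSpace.abs_apply_le_norm v j) (norm_nonneg _) hb0
    _ = d * b * ‖v‖ := by simp [mul_assoc]

theorem EuclideanSpace.norm_le_sum_abs (v : EuclideanSpace ℝ (Fin d)) : ‖v‖ ≤ ∑ j, |v j| := by
  conv_lhs => rw [EuclideanSpace.eq_sum_smul_single v]
  refine (norm_sum_le _ _).trans (Finset.sum_le_sum fun j _ => ?_)
  rw [norm_smul]
  simp

theorem comparable_of_mem_closedBall {r : ℝ} (hr : r ≤ 1 / 2) {ζ ξ : EuclideanSpace ℝ (Fin d)}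
    (hξ : ξ ∈ Metric.closedBall ζ (r * ‖ζ‖)) : ‖ξ‖ ≤ 2 * ‖ζ‖ ∧ ‖ζ‖ ≤ 2 * ‖ξ‖ := by
  rw [Metric.mem_closedBall, dist_eq_norm] at hξ
  have h0 := mul_le_mul_of_nonneg_right hr (norm_nonneg ζ)
  have h1 := norm_sub_norm_le ξ ζ
  have h2 := norm_sub_norm_le ζ ξ
  rw [norm_sub_rev] at h2
  constructor <;> linarith [norm_nonneg ζ]

theorem IsAlmostHomogeneousWith.partialDeriv_comm
    (hφ : IsAlmostHomogeneousWith α B lam d₁ d₂ φ) {ξ : EuclideanSpace ℝ (Fin d)} (hξ : ξ ≠ 0)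
    (i j : Fin d) : partialDeriv φ ![i, j] ξ = partialDeriv φ ![j, i] ξ := by
  have hat : ContDiffAt ℝ ((d + 2 : ℕ) : ℕ∞) φ ξ :=
    hφ.contDiffOn.contDiffAt (isOpen_compl_singleton.mem_nhds hξ)
  have h2 : IsSymmSndFDerivAt ℝ φ ξ := hat.isSymmSndFDerivAt (by
    rw [minSmoothness_of_isRCLikeNormedField]
    exact Nat.ofNat_le_cast.2 (by omega))
  simp only [partialDeriv, iteratedFDeriv_two_apply]
  exact h2 _ _

/-- Quantitative local injectivity of the gradient: on a ball around `ζ` of radius a small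
multiple of `|ζ|`, the Hessian at `ζ`, which expands vectors by at least `lam |ζ|^{α-2}`,
dominates its own variation, which is controlled by the third derivatives. -/
theorem IsAlmostHomogeneousWith.exists_le_norm_gradient_sub (hd : 1 ≤ d)
    (hφ : IsAlmostHomogeneousWith α B lam d₁ d₂ φ) (hB : 0 < B) (hlam : 0 < lam) :
    ∃ r c : ℝ, 0 < r ∧ r ≤ 1 / 2 ∧ 0 < c ∧ ∀ ζ : EuclideanSpace ℝ (Fin d), ζ ≠ 0 →
      ∀ ξ ∈ Metric.closedBall ζ (r * ‖ζ‖), ∀ ξ' ∈ Metric.closedBall ζ (r * ‖ζ‖),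
        c * ‖ζ‖ ^ (α - 2) * ‖ξ - ξ'‖ ≤ ‖gradient φ ξ - gradient φ ξ'‖ := by
  have hd0 : (0 : ℝ) < d := by exact_mod_cast hd
  -- `2 ^ |α - 3|` compares `‖η‖ ^ (α - 3)` with `‖ζ‖ ^ (α - 3)` on the ball, and each factor `d`
  -- comes from estimating a Euclidean or operator norm by coordinates.
  set K : ℝ := d * (d * (d * (B * 2 ^ |α - 3|))) with hK
  have hKpos : 0 < K := by positivity
  refine ⟨min (1 / 2) (lam / (2 * K)), lam / 2, by positivity, min_le_left _ _, by positivity, ?_⟩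
  set r := min (1 / 2) (lam / (2 * K)) with hr
  have hr0 : 0 < r := by positivity
  have hr2 : r ≤ 1 / 2 := min_le_left _ _
  have hrK : K * r ≤ lam / 2 := by
    have := min_le_right (1 / 2) (lam / (2 * K))
    rw [← hr, le_div_iff₀ (by positivity)] at this
    linarith
  intro ζ hζ ξ hξ ξ' hξ'
  have hζ' := norm_pos_iff.2 hζ
  set D := Metric.closedBall ζ (r * ‖ζ‖) with hD
  have hDc : Convex ℝ D := convex_closedBall _ _
  have hζD : ζ ∈ D := Metric.mem_closedBall_self (by positivity)
  have hcomp : ∀ η ∈ D, ‖η‖ ≤ 2 * ‖ζ‖ ∧ ‖ζ‖ ≤ 2 * ‖η‖ := fun η hη =>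
    comparable_of_mem_closedBall hr2 hη
  have hne : ∀ η ∈ D, η ≠ 0 := fun η hη h0 => by
    have := (hcomp η hη).2
    rw [h0, norm_zero] at this
    linarith
  -- second derivatives vary little on `D`
  have hsecond : ∀ i j, ∀ η ∈ D, |partialDeriv φ ![i, j] η - partialDeriv φ ![i, j] ζ| ≤
      d * (B * 2 ^ |α - 3|) * r * ‖ζ‖ ^ (α - 2) := by
    intro i j η hη
    have h := hDc.norm_image_sub_le_of_norm_fderiv_le (𝕜 := ℝ) (f := partialDeriv φ ![i, j])
      (C := d * (B * 2 ^ |α - 3| * ‖ζ‖ ^ (α - 3)))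
      (fun η hη =>
        (differentiableAt_and_fderiv_partialDeriv hφ.contDiffOn (by omega) _ (hne η hη)).1)
      (fun η hη => EuclideanSpace.opNorm_le_of_single (fun k => ?_) (by positivity)) hζD hη
    · rw [Real.norm_eq_abs] at h
      refine h.trans ?_
      rw [Metric.mem_closedBall, dist_eq_norm] at hη
      have e : ‖ζ‖ ^ (α - 2) = ‖ζ‖ ^ (α - 3) * ‖ζ‖ := by
        rw [← Real.rpow_add_one hζ'.ne']
        congr 1
        ring
      rw [e]
      calc _ ≤ d * (B * 2 ^ |α - 3| * ‖ζ‖ ^ (α - 3)) * (r * ‖ζ‖) := by gcongr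
        _ = _ := by ring
    · rw [(differentiableAt_and_fderiv_partialDeriv hφ.contDiffOn (by omega) _ (hne η hη)).2 k]
      refine (hφ.deriv_le η (hne η hη) 3 (by omega) _).trans ?_
      have := Real.rpow_le_mul_rpow_of_comparable (norm_pos_iff.2 (hne η hη)) hζ' two_pos
        (hcomp η hη).1 (hcomp η hη).2 (α - 3)
      rw [mul_assoc]
      gcongr
      exact_mod_cast this
  -- the mean value inequality for the first derivatives, linearised at `ζ`
  have hfirst : ∀ j, |partialDeriv φ ![j] ξ - partialDeriv φ ![j] ξ' -
      fderiv ℝ (partialDeriv φ ![j]) ζ (ξ - ξ')| ≤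
        d * (d * (B * 2 ^ |α - 3|) * r * ‖ζ‖ ^ (α - 2)) * ‖ξ - ξ'‖ := by
    intro j
    refine hDc.norm_image_sub_le_of_norm_fderiv_le' (𝕜 := ℝ) (f := partialDeriv φ ![j])
      (fun η hη =>
        (differentiableAt_and_fderiv_partialDeriv hφ.contDiffOn (by omega) _ (hne η hη)).1)
      (fun η hη => EuclideanSpace.opNorm_le_of_single (fun k => ?_) (by positivity)) hξ' hξ
    rw [sub_apply,
      (differentiableAt_and_fderiv_partialDeriv hφ.contDiffOn (by omega) _ (hne η hη)).2 k,
      (differentiableAt_and_fderiv_partialDeriv hφ.contDiffOn (by omega) _ hζ).2 k]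
    exact hsecond k j η hη
  -- the linearisation at `ζ` is the Hessian
  have hlin : ∀ v : EuclideanSpace ℝ (Fin d), ∀ j, fderiv ℝ (partialDeriv φ ![j]) ζ v =
      Matrix.toEuclideanLin (hessianMatrix φ ζ) v j := by
    intro v j
    conv_lhs => rw [EuclideanSpace.eq_sum_smul_single v, map_sum]
    have h1 := differentiableAt_and_fderiv_partialDeriv hφ.contDiffOn (by omega) ![j] hζ
    simp only [map_smul, h1.2]
    simp only [Matrix.toLpLin_apply, Matrix.mulVec, dotProduct, hessianMatrix, Matrix.of_apply]
    refine Finset.sum_congr rfl fun k _ => ?_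
    rw [hφ.partialDeriv_comm hζ j k, smul_eq_mul, mul_comm]
    rfl
  have hlow : lam * ‖ζ‖ ^ (α - 2) * ‖ξ - ξ'‖ ≤
      ‖Matrix.toEuclideanLin (hessianMatrix φ ζ) (ξ - ξ')‖ := by
    rcases eq_or_ne (ξ - ξ') 0 with h0 | h0
    · simp [h0]
    · have h1 := hφ.hessian ζ hζ (‖ξ - ξ'‖⁻¹ • (ξ - ξ')) (norm_smul_inv_norm h0)
      rw [map_smul, norm_smul, norm_inv, norm_norm, inv_mul_eq_div,
        le_div_iff₀ (norm_pos_iff.2 h0)] at h1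
      exact h1
  have hdiff : ‖gradient φ ξ - gradient φ ξ' -
      Matrix.toEuclideanLin (hessianMatrix φ ζ) (ξ - ξ')‖ ≤
        K * r * ‖ζ‖ ^ (α - 2) * ‖ξ - ξ'‖ := by
    refine (EuclideanSpace.norm_le_sum_abs _).trans ?_
    calc _ ≤ ∑ _j : Fin d, d * (d * (B * 2 ^ |α - 3|) * r * ‖ζ‖ ^ (α - 2)) * ‖ξ - ξ'‖ := by
          refine Finset.sum_le_sum fun j _ => ?_
          have := hfirst j
          rw [hlin] at this
          simpa only [PiLp.sub_apply, gradient_apply] using this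
      _ = _ := by
          simp [hK]
          ring
  have h1 := norm_sub_norm_le (Matrix.toEuclideanLin (hessianMatrix φ ζ) (ξ - ξ'))
    (gradient φ ξ - gradient φ ξ')
  rw [norm_sub_rev (Matrix.toEuclideanLin _ _)] at h1
  have h2 : K * r * (‖ζ‖ ^ (α - 2) * ‖ξ - ξ'‖) ≤ lam / 2 * (‖ζ‖ ^ (α - 2) * ‖ξ - ξ'‖) := by gcongr
  linarith

end Geometry

/-! ### Integrating the gain -/

namespace PhaseParams

variable {d : ℕ} {α c B lam d₁ d₂ : ℝ} {φ : EuclideanSpace ℝ (Fin d) → ℝ}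

theorem weight_eq (p : PhaseParams d) (ξ : EuclideanSpace ℝ (Fin d)) :
    p.weight α φ ξ = 1 + ‖ξ‖ ^ (2 - α) / |p.t| * ‖p.x + p.t • gradient φ ξ‖ ^ 2 := by
  rw [weight, EuclideanSpace.real_norm_sq_eq]
  simp [phaseGrad, gradient_apply]

/-- On a ball on which the gradient is quantitatively injective, the weight is bounded below by
`1 + μ²|ξ - ξ₀|²` with `μ² ∼ |t| |ζ|^{α-2}`, where `ξ₀` minimises the gradient of the phase on the
ball. -/
theorem exists_lintegral_closedBall_weight_le (hd : 1 ≤ d)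
    (hφ : IsAlmostHomogeneousWith α B lam d₁ d₂ φ)
    (hB : 0 < B) (hlam : 0 < lam) :
    ∃ r C : ℝ, 0 < r ∧ 0 ≤ C ∧ ∀ (p : PhaseParams d) (ζ : EuclideanSpace ℝ (Fin d)), ζ ≠ 0 →
      ∫⁻ ξ in Metric.closedBall ζ (r * ‖ζ‖),
        ENNReal.ofReal (‖ξ‖ ^ (d * (α - 2) / 2) * (p.weight α φ ξ ^ d)⁻¹) ≤
          ENNReal.ofReal (C * |p.t| ^ (-(d : ℝ) / 2)) := by
  obtain ⟨r, c, hr, hr2, hc, hgrad⟩ := hφ.exists_le_norm_gradient_sub hd hB hlam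
  obtain ⟨J, hJ, hbr⟩ := exists_lintegral_inv_one_add_sq_pow_le hd
  set c₄ : ℝ := ((2 : ℝ) ^ |2 - α|)⁻¹ * (c ^ 2 / 4) with hc₄
  have hc₄pos : 0 < c₄ := by positivity
  refine ⟨r, 2 ^ |d * (α - 2) / 2| * (J * c₄ ^ (-(d : ℝ) / 2)), hr, by positivity,
    fun p ζ hζ => ?_⟩
  have hζ' := norm_pos_iff.2 hζ
  have ht := p.abs_t_pos
  set D := Metric.closedBall ζ (r * ‖ζ‖) with hD
  have hcomp : ∀ η ∈ D, ‖η‖ ≤ 2 * ‖ζ‖ ∧ ‖ζ‖ ≤ 2 * ‖η‖ := fun η hη =>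
    comparable_of_mem_closedBall hr2 hη
  have hpos : ∀ η ∈ D, 0 < ‖η‖ := fun η hη => by linarith [(hcomp η hη).2]
  -- continuity on the compact ball provides a point where the phase gradient is smallest
  have hcont : ContinuousOn (fun ξ => ‖p.x + p.t • gradient φ ξ‖) D := by
    have : ContinuousOn (gradient φ) D := fun ξ hξ => by
      have hat : ContDiffAt ℝ ((d + 2 : ℕ) : ℕ∞) φ ξ :=
        hφ.contDiffOn.contDiffAt (isOpen_compl_singleton.mem_nhds (norm_pos_iff.1 (hpos ξ hξ)))
      exact ((InnerProductSpace.toDual ℝ _).symm.continuous.continuousAt.comp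
        (hat.continuousAt_fderiv (by simp))).continuousWithinAt
    exact (continuousOn_const.add (this.const_smul p.t)).norm
  obtain ⟨ξ₀, hξ₀, hmin⟩ := (isCompact_closedBall ζ (r * ‖ζ‖)).exists_isMinOn
    ⟨ζ, Metric.mem_closedBall_self (by positivity)⟩ hcont
  set μ : ℝ := √(c₄ * |p.t| * ‖ζ‖ ^ (α - 2)) with hμ
  have hμpos : 0 < μ := Real.sqrt_pos.2 (by positivity)
  -- the phase gradient grows linearly away from the point where it is smallest
  have hlow : ∀ ξ ∈ D, c / 2 * |p.t| * ‖ζ‖ ^ (α - 2) * ‖ξ - ξ₀‖ ≤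
      ‖p.x + p.t • gradient φ ξ‖ := fun ξ hξ => by
    have h1 : ‖p.x + p.t • gradient φ ξ₀‖ ≤ ‖p.x + p.t • gradient φ ξ‖ := hmin hξ
    have h2 := hgrad ζ hζ ξ hξ ξ₀ hξ₀
    -- `x` drops out of the difference of two phase gradients
    have h3 : |p.t| * ‖gradient φ ξ - gradient φ ξ₀‖ =
        ‖(p.x + p.t • gradient φ ξ) - (p.x + p.t • gradient φ ξ₀)‖ := by
      rw [add_sub_add_left_eq_sub, ← smul_sub, norm_smul, Real.norm_eq_abs]
    have h4 := norm_sub_le (p.x + p.t • gradient φ ξ) (p.x + p.t • gradient φ ξ₀)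
    have h5 := mul_le_mul_of_nonneg_left h2 ht.le
    linarith
  have hw : ∀ ξ ∈ D, 1 + (μ * ‖ξ - ξ₀‖) ^ 2 ≤ p.weight α φ ξ := fun ξ hξ => by
    have h1 := Real.rpow_le_mul_rpow_of_comparable hζ' (hpos ξ hξ) two_pos
      (hcomp ξ hξ).2 (hcomp ξ hξ).1 (2 - α)
    have h2 := pow_le_pow_left₀ (by positivity) (hlow ξ hξ) 2
    have h3 : ((2 : ℝ) ^ |2 - α|)⁻¹ * ‖ζ‖ ^ (2 - α) ≤ ‖ξ‖ ^ (2 - α) := by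
      rw [inv_mul_le_iff₀ (by positivity)]; exact h1
    have e : ‖ζ‖ ^ (2 - α) = (‖ζ‖ ^ (α - 2))⁻¹ := by
      rw [← Real.rpow_neg hζ'.le]; congr 1; ring
    have e' : (μ * ‖ξ - ξ₀‖) ^ 2 = ((2 : ℝ) ^ |2 - α|)⁻¹ * ‖ζ‖ ^ (2 - α) / |p.t| *
        (c / 2 * |p.t| * ‖ζ‖ ^ (α - 2) * ‖ξ - ξ₀‖) ^ 2 := by
      have : 0 < ‖ζ‖ ^ (α - 2) := by positivity
      rw [mul_pow, hμ, Real.sq_sqrt (by positivity), e, hc₄]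
      field_simp
      ring
    rw [weight_eq, e']
    gcongr
  calc _ ≤ ∫⁻ ξ in D, ENNReal.ofReal (2 ^ |d * (α - 2) / 2| * ‖ζ‖ ^ (d * (α - 2) / 2)) *
          ENNReal.ofReal (((1 + (μ * ‖ξ - ξ₀‖) ^ 2) ^ d)⁻¹) := by
        refine setLIntegral_mono' measurableSet_closedBall fun ξ hξ => ?_
        rw [← ENNReal.ofReal_mul (by positivity)]
        have h1 := Real.rpow_le_mul_rpow_of_comparable (hpos ξ hξ) hζ' two_pos
          (hcomp ξ hξ).1 (hcomp ξ hξ).2 (d * (α - 2) / 2)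
        have h2 := hw ξ hξ
        have h3 := p.weight_pos (α := α) (φ := φ) ξ
        gcongr
    _ ≤ ∫⁻ ξ, ENNReal.ofReal (2 ^ |d * (α - 2) / 2| * ‖ζ‖ ^ (d * (α - 2) / 2)) *
          ENNReal.ofReal (((1 + (μ * ‖ξ - ξ₀‖) ^ 2) ^ d)⁻¹) := setLIntegral_le_lintegral _ _
    _ ≤ ENNReal.ofReal (2 ^ |d * (α - 2) / 2| * ‖ζ‖ ^ (d * (α - 2) / 2)) *
          ENNReal.ofReal (J * μ ^ (-(d : ℝ))) := by
        rw [lintegral_const_mul' _ _ ENNReal.ofReal_ne_top]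
        gcongr
        exact hbr μ ξ₀ hμpos
    _ = _ := by
        rw [← ENNReal.ofReal_mul (by positivity)]
        congr 1
        have e : μ ^ (-(d : ℝ)) = c₄ ^ (-(d : ℝ) / 2) * |p.t| ^ (-(d : ℝ) / 2) *
            (‖ζ‖ ^ (d * (α - 2) / 2))⁻¹ := by
          rw [hμ, Real.sqrt_eq_rpow, ← Real.rpow_mul (by positivity), Real.mul_rpow (by positivity)
            (by positivity), Real.mul_rpow hc₄pos.le ht.le, ← Real.rpow_mul hζ'.le,
            ← Real.rpow_neg hζ'.le]
          congr 2
          · congr 1; ring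
          · congr 1; ring
          · ring
        have : 0 < ‖ζ‖ ^ (d * (α - 2) / 2) := by positivity
        rw [e]
        field_simp

/-- The resonant set, where the gradient of the phase is small compared with `|t| |ξ|^{α-1}`, the
size of `t∇φ`. -/
def resonantSet (φ : EuclideanSpace ℝ (Fin d) → ℝ) (α d₁ : ℝ) (p : PhaseParams d) :
    Set (EuclideanSpace ℝ (Fin d)) :=
  {ξ | ξ ≠ 0 ∧ ‖p.x + p.t • gradient φ ξ‖ < d₁ / 2 * (|p.t| * ‖ξ‖ ^ (α - 1))}

/-- Resonant points have comparable norms: `|ξ|^{α-1}` is comparable to `|x| / |t|` on the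
resonant set, and `α ≠ 1`. -/
theorem exists_norm_le_of_mem_resonantSet (hφ : IsAlmostHomogeneousWith α B lam d₁ d₂ φ)
    (hα1 : α ≠ 1) (hd₁ : 0 < d₁) (hd₂ : 0 < d₂) :
    ∃ C : ℝ, 0 < C ∧ ∀ (p : PhaseParams d), ∀ ξ ∈ p.resonantSet φ α d₁,
      ∀ ξ' ∈ p.resonantSet φ α d₁, ‖ξ‖ ≤ C * ‖ξ'‖ := by
  -- on the resonant set `|x|` lies between `d₁ / 2` and `d₂ + d₁ / 2` times `|t| ‖ξ‖ ^ (α - 1)`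
  set C₂ : ℝ := (d₂ + d₁ / 2) / (d₁ / 2) with hC₂
  have hC₂pos : 0 < C₂ := by positivity
  have hβ : α - 1 ≠ 0 := sub_ne_zero.2 hα1
  have hcmp : ∀ (p : PhaseParams d), ∀ ξ ∈ p.resonantSet φ α d₁,
      ∀ ξ' ∈ p.resonantSet φ α d₁, ‖ξ‖ ^ (α - 1) ≤ C₂ * ‖ξ'‖ ^ (α - 1) := by
    intro p ξ hξ ξ' hξ'
    have ht := p.abs_t_pos
    have h1 := norm_sub_norm_le (p.t • gradient φ ξ) (-p.x)
    have h2 := norm_sub_norm_le p.x (-(p.t • gradient φ ξ'))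
    rw [sub_neg_eq_add, norm_neg, norm_smul, Real.norm_eq_abs, add_comm (p.t • _)] at h1
    rw [sub_neg_eq_add, norm_neg, norm_smul, Real.norm_eq_abs] at h2
    have h3 := mul_le_mul_of_nonneg_left (hφ.le_norm_gradient ξ hξ.1) ht.le
    have h4 := mul_le_mul_of_nonneg_left (hφ.norm_gradient_le ξ' hξ'.1) ht.le
    have h5 := hξ.2
    have h6 := hξ'.2
    have h7 : |p.t| * (d₁ / 2 * ‖ξ‖ ^ (α - 1)) ≤ |p.t| * ((d₂ + d₁ / 2) * ‖ξ'‖ ^ (α - 1)) := by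
      linarith
    have h8 := le_of_mul_le_mul_left h7 ht
    rw [hC₂, div_mul_eq_mul_div, le_div_iff₀ (by positivity)]
    linarith
  refine ⟨C₂ ^ |(α - 1)⁻¹|, by positivity, fun p ξ hξ ξ' hξ' => ?_⟩
  have hξ0 := norm_pos_iff.2 hξ.1
  have hξ'0 := norm_pos_iff.2 hξ'.1
  have := Real.rpow_le_mul_rpow_of_comparable (by positivity) (by positivity) hC₂pos
    (hcmp p ξ hξ ξ' hξ') (hcmp p ξ' hξ' ξ hξ) (α - 1)⁻¹
  rwa [Real.rpow_rpow_inv hξ0.le hβ, Real.rpow_rpow_inv hξ'0.le hβ] at this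

/-- By the comparability of norms the resonant set lies in a dilate of a fixed annulus, which
finitely many balls `B(η, r|η|)` cover; the dilates of these balls cover the resonant set. -/
theorem exists_lintegral_resonantSet_weight_le (hd : 1 ≤ d)
    (hφ : IsAlmostHomogeneousWith α B lam d₁ d₂ φ)
    (hα1 : α ≠ 1) (hB : 0 < B) (hlam : 0 < lam) (hd₁ : 0 < d₁) (hd₂ : 0 < d₂) :
    ∃ C : ℝ, 0 ≤ C ∧ ∀ p : PhaseParams d, ∫⁻ ξ in p.resonantSet φ α d₁,
        ENNReal.ofReal (‖ξ‖ ^ (d * (α - 2) / 2) * (p.weight α φ ξ ^ d)⁻¹) ≤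
          ENNReal.ofReal (C * |p.t| ^ (-(d : ℝ) / 2)) := by
  obtain ⟨r, C, hr, hC, hball⟩ := exists_lintegral_closedBall_weight_le hd hφ hB hlam
  obtain ⟨K, hK, hann⟩ := exists_norm_le_of_mem_resonantSet hφ hα1 hd₁ hd₂
  set A : Set (EuclideanSpace ℝ (Fin d)) := {η | K⁻¹ ≤ ‖η‖ ∧ ‖η‖ ≤ K} with hA
  have hAc : IsCompact A := by
    refine (isCompact_closedBall (0 : EuclideanSpace ℝ (Fin d)) K).of_isClosed_subset
      ((isClosed_le continuous_const continuous_norm).inter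
        (isClosed_le continuous_norm continuous_const)) fun η hη => ?_
    simpa using hη.2
  have hA0 : ∀ η ∈ A, 0 < ‖η‖ := fun η hη => (inv_pos.2 hK).trans_le hη.1
  obtain ⟨T, hTA, hT⟩ := hAc.elim_nhds_subcover (fun η => Metric.closedBall η (r * ‖η‖))
    fun η hη => Metric.closedBall_mem_nhds _ (mul_pos hr (hA0 η hη))
  refine ⟨T.card * C, by positivity, fun p => ?_⟩
  rcases (p.resonantSet φ α d₁).eq_empty_or_nonempty with he | ⟨ξ', hξ'⟩
  · simp [he]
  have hR := norm_pos_iff.2 hξ'.1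
  set R := ‖ξ'‖ with hRdef
  have hsub : p.resonantSet φ α d₁ ⊆ ⋃ η ∈ T, Metric.closedBall (R • η) (r * ‖R • η‖) := by
    intro ξ hξ
    have hmem : R⁻¹ • ξ ∈ A := by
      have h1 := hann p ξ hξ ξ' hξ'
      have h2 := hann p ξ' hξ' ξ hξ
      refine ⟨?_, ?_⟩ <;> rw [norm_smul, norm_inv, Real.norm_of_nonneg hR.le, inv_mul_eq_div]
      · rw [le_div_iff₀ hR, inv_mul_le_iff₀ hK]
        exact h2
      · rw [div_le_iff₀ hR]
        exact h1
    have := hT hmem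
    simp only [Set.mem_iUnion] at this ⊢
    obtain ⟨η, hη, hb⟩ := this
    refine ⟨η, hη, ?_⟩
    rw [Metric.mem_closedBall, dist_eq_norm] at hb ⊢
    have e : ξ - R • η = R • (R⁻¹ • ξ - η) := by
      rw [smul_sub, smul_inv_smul₀ hR.ne']
    rw [e, norm_smul, norm_smul, Real.norm_of_nonneg hR.le, mul_left_comm]
    gcongr
  calc _ ≤ ∫⁻ ξ in ⋃ η ∈ T, Metric.closedBall (R • η) (r * ‖R • η‖),
        ENNReal.ofReal (‖ξ‖ ^ (d * (α - 2) / 2) * (p.weight α φ ξ ^ d)⁻¹) :=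
        lintegral_mono_set hsub
    _ ≤ ∑ η ∈ T, ∫⁻ ξ in Metric.closedBall (R • η) (r * ‖R • η‖),
        ENNReal.ofReal (‖ξ‖ ^ (d * (α - 2) / 2) * (p.weight α φ ξ ^ d)⁻¹) := by
        have e : ⋃ η ∈ T, Metric.closedBall (R • η) (r * ‖R • η‖) =
            ⋃ η : T, Metric.closedBall (R • (η : EuclideanSpace ℝ (Fin d)))
              (r * ‖R • (η : EuclideanSpace ℝ (Fin d))‖) := by
          ext
          simp
        rw [← Finset.sum_coe_sort, ← tsum_fintype (L := .unconditional _), e]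
        exact lintegral_iUnion_le _ _
    _ ≤ ∑ _η ∈ T, ENNReal.ofReal (C * |p.t| ^ (-(d : ℝ) / 2)) :=
        Finset.sum_le_sum fun η hη => hball p _
          (smul_ne_zero hR.ne' (norm_pos_iff.1 (hA0 η (hTA η hη))))
    _ = _ := by
        rw [Finset.sum_const, nsmul_eq_mul, mul_assoc, ENNReal.ofReal_mul (Nat.cast_nonneg _),
          ENNReal.ofReal_natCast]

/-- The integral of `|ξ|^{d(α-2)/2} s^{-d}` over the region `s > c`. The integrand is `|t|^{-d}
|ξ|^{-d-dα/2}`, and the region is the outside of a ball if `α > 0` and a ball if `α < 0`; in both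
cases the exponent is on the convergent side. -/
theorem exists_lintegral_large_size (hd : 1 ≤ d) (hα0 : α ≠ 0) (hc : 0 < c) :
    ∃ C : ℝ, 0 ≤ C ∧ ∀ p : PhaseParams d, ∫⁻ ξ in {ξ | ξ ≠ 0 ∧ c < p.size α ξ},
        ENNReal.ofReal (‖ξ‖ ^ (d * (α - 2) / 2) * (p.size α ξ ^ d)⁻¹) ≤
          ENNReal.ofReal (C * |p.t| ^ (-(d : ℝ) / 2)) := by
  have hd0 : (0 : ℝ) < d := by exact_mod_cast hd
  have key : ∃ C : ℝ, 0 ≤ C ∧ ∀ p : PhaseParams d, ∫⁻ ξ in {ξ | ξ ≠ 0 ∧ c < p.size α ξ},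
      ENNReal.ofReal (‖ξ‖ ^ (-d - d * α / 2 : ℝ)) ≤
        ENNReal.ofReal (C * (|p.t| ^ α⁻¹) ^ (-d - (-d - d * α / 2) : ℝ)) := by
    rcases lt_or_gt_of_ne hα0 with hα | hα
    · obtain ⟨C, hC, H⟩ := exists_setLIntegral_norm_rpow_le hd
        (by nlinarith : -(d : ℝ) < -d - d * α / 2) (c ^ α⁻¹)
      refine ⟨C, hC, fun p => (lintegral_mono_set fun ξ hξ => ?_).trans
        (H _ (Real.rpow_pos_of_pos p.abs_t_pos _))⟩
      have h1 : 0 < |p.t| ^ α⁻¹ * ‖ξ‖ :=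
        mul_pos (Real.rpow_pos_of_pos p.abs_t_pos _) (norm_pos_iff.2 hξ.1)
      have h2 := hξ.2
      rw [size_eq_rpow hα0] at h2
      have := Real.rpow_le_rpow_of_nonpos hc h2.le (inv_neg''.2 hα).le
      rwa [Real.rpow_rpow_inv h1.le hα0] at this
    · obtain ⟨C, hC, H⟩ := exists_setLIntegral_norm_rpow_ge hd
        (by nlinarith : -d - d * α / 2 < -(d : ℝ)) (Real.rpow_pos_of_pos hc α⁻¹)
      refine ⟨C, hC, fun p => (lintegral_mono_set fun ξ hξ => ?_).trans
        (H _ (Real.rpow_pos_of_pos p.abs_t_pos _))⟩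
      have h1 : 0 < |p.t| ^ α⁻¹ * ‖ξ‖ :=
        mul_pos (Real.rpow_pos_of_pos p.abs_t_pos _) (norm_pos_iff.2 hξ.1)
      have h2 := hξ.2
      rw [size_eq_rpow hα0] at h2
      have := Real.rpow_le_rpow hc.le h2.le (inv_pos.2 hα).le
      rwa [Real.rpow_rpow_inv h1.le hα0] at this
  obtain ⟨C, hC, H⟩ := key
  refine ⟨C, hC, fun p => ?_⟩
  have ht := p.abs_t_pos
  have hm : MeasurableSet {ξ : EuclideanSpace ℝ (Fin d) | ξ ≠ 0 ∧ c < p.size α ξ} :=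
    (p.isOpen_lt_size α c).measurableSet
  calc _ = ∫⁻ ξ in {ξ | ξ ≠ 0 ∧ c < p.size α ξ}, ENNReal.ofReal (|p.t| ^ (-(d : ℝ))) *
        ENNReal.ofReal (‖ξ‖ ^ (-d - d * α / 2 : ℝ)) := by
        refine setLIntegral_congr_fun hm fun ξ hξ => ?_
        have hξ' := norm_pos_iff.2 hξ.1
        rw [← ENNReal.ofReal_mul (by positivity)]
        congr 1
        rw [size, mul_pow, mul_inv, ← Real.rpow_natCast, ← Real.rpow_natCast,
          ← Real.rpow_neg ht.le, ← Real.rpow_mul hξ'.le, ← Real.rpow_neg hξ'.le, mul_left_comm,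
          ← Real.rpow_add hξ']
        congr 2
        ring
    _ ≤ ENNReal.ofReal (|p.t| ^ (-(d : ℝ))) *
          ENNReal.ofReal (C * (|p.t| ^ α⁻¹) ^ (-d - (-d - d * α / 2) : ℝ)) := by
        rw [lintegral_const_mul' _ _ ENNReal.ofReal_ne_top]
        gcongr
        exact H p
    _ = _ := by
        rw [← ENNReal.ofReal_mul (by positivity)]
        congr 1
        rw [mul_left_comm, ← Real.rpow_mul ht.le, ← Real.rpow_add ht]
        congr 2
        field_simp
        ring

/-- The integral of `|ξ|^{d(α-2)/2}` over the region `s ≤ c`. -/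
theorem exists_lintegral_small_size (hd : 1 ≤ d) (hα0 : α ≠ 0) (hc : 0 < c) :
    ∃ C : ℝ, 0 ≤ C ∧ ∀ p : PhaseParams d, ∫⁻ ξ in {ξ | ξ ≠ 0 ∧ p.size α ξ ≤ c},
        ENNReal.ofReal (‖ξ‖ ^ (d * (α - 2) / 2)) ≤
          ENNReal.ofReal (C * |p.t| ^ (-(d : ℝ) / 2)) := by
  have hd0 : (0 : ℝ) < d := by exact_mod_cast hd
  have hexp : ∀ p : PhaseParams d, (|p.t| ^ α⁻¹) ^ (-d - (d * (α - 2) / 2) : ℝ) =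
      |p.t| ^ (-(d : ℝ) / 2) := fun p => by
    rw [← Real.rpow_mul (abs_nonneg _)]
    congr 1
    field_simp
    ring
  rcases lt_or_gt_of_ne hα0 with hα | hα
  · obtain ⟨C, hC, H⟩ := exists_setLIntegral_norm_rpow_ge hd
      (by nlinarith : d * (α - 2) / 2 < -(d : ℝ)) (Real.rpow_pos_of_pos hc α⁻¹)
    refine ⟨C, hC, fun p => (lintegral_mono_set fun ξ hξ => ?_).trans
      ((H _ (Real.rpow_pos_of_pos p.abs_t_pos _)).trans_eq (by rw [hexp]))⟩
    have h1 : 0 < |p.t| ^ α⁻¹ * ‖ξ‖ :=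
      mul_pos (Real.rpow_pos_of_pos p.abs_t_pos _) (norm_pos_iff.2 hξ.1)
    have h2 := hξ.2
    rw [size_eq_rpow hα0] at h2
    have := Real.rpow_le_rpow_of_nonpos (Real.rpow_pos_of_pos h1 _) h2 (inv_neg''.2 hα).le
    rwa [Real.rpow_rpow_inv h1.le hα0] at this
  · obtain ⟨C, hC, H⟩ := exists_setLIntegral_norm_rpow_le hd
      (by nlinarith : -(d : ℝ) < d * (α - 2) / 2) (c ^ α⁻¹)
    refine ⟨C, hC, fun p => (lintegral_mono_set fun ξ hξ => ?_).trans
      ((H _ (Real.rpow_pos_of_pos p.abs_t_pos _)).trans_eq (by rw [hexp]))⟩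
    have h1 : 0 < |p.t| ^ α⁻¹ * ‖ξ‖ :=
      mul_pos (Real.rpow_pos_of_pos p.abs_t_pos _) (norm_pos_iff.2 hξ.1)
    have h2 := hξ.2
    rw [size_eq_rpow hα0] at h2
    have := Real.rpow_le_rpow (Real.rpow_pos_of_pos h1 _).le h2 (inv_pos.2 hα).le
    rwa [Real.rpow_rpow_inv h1.le hα0] at this

/-- If `w ≤ s` then `(s w)^{1/2} ≥ w`, and otherwise `(s w)^{1/2} ≥ s`. -/
theorem gain_le (p : PhaseParams d) {ξ : EuclideanSpace ℝ (Fin d)} (hξ : ξ ≠ 0) :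
    p.gain α φ ξ ≤ 2 * ((p.weight α φ ξ)⁻¹ + (p.size α ξ)⁻¹) := by
  have hw := p.weight_pos (α := α) (φ := φ) ξ
  have hs := p.size_pos (α := α) hξ
  set w := p.weight α φ ξ
  set s := p.size α ξ
  have hwi : 0 < w⁻¹ := inv_pos.2 hw
  have hsi : 0 < s⁻¹ := inv_pos.2 hs
  have hgain : p.gain α φ ξ = w⁻¹ + (√(s * w))⁻¹ := by
    rw [gain, Real.sqrt_mul hs.le]
  rw [hgain]
  rcases le_total w s with h | h
  · have h1 : w ≤ √(s * w) := Real.le_sqrt_of_sq_le (by nlinarith)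
    have h2 : (√(s * w))⁻¹ ≤ w⁻¹ := inv_anti₀ hw h1
    linarith
  · have h1 : s ≤ √(s * w) := Real.le_sqrt_of_sq_le (by nlinarith)
    have h2 : (√(s * w))⁻¹ ≤ s⁻¹ := inv_anti₀ hs h1
    linarith

theorem weight_inv_le_of_notMem_resonantSet (hd₁ : 0 < d₁) (p : PhaseParams d)
    {ξ : EuclideanSpace ℝ (Fin d)} (hξ : ξ ≠ 0) (hr : ξ ∉ p.resonantSet φ α d₁) :
    (p.weight α φ ξ)⁻¹ ≤ 4 / d₁ ^ 2 * (p.size α ξ)⁻¹ := by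
  have hξ' := norm_pos_iff.2 hξ
  have ht := p.abs_t_pos
  have hs := p.size_pos (α := α) hξ
  have h1 : d₁ / 2 * (|p.t| * ‖ξ‖ ^ (α - 1)) ≤ ‖p.x + p.t • gradient φ ξ‖ := by
    by_contra h
    exact hr ⟨hξ, not_le.1 h⟩
  have h2 := pow_le_pow_left₀ (by positivity) h1 2
  have h3 : d₁ ^ 2 / 4 * p.size α ξ ≤ p.weight α φ ξ := by
    have e : d₁ ^ 2 / 4 * p.size α ξ =
        ‖ξ‖ ^ (2 - α) / |p.t| * (d₁ / 2 * (|p.t| * ‖ξ‖ ^ (α - 1))) ^ 2 := by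
      have e1 : ‖ξ‖ ^ α = ‖ξ‖ ^ (2 - α) * (‖ξ‖ ^ (α - 1)) ^ 2 := by
        rw [← Real.rpow_natCast, ← Real.rpow_mul hξ'.le, ← Real.rpow_add hξ']
        congr 1
        push_cast
        ring
      rw [size, e1]
      field_simp
      ring
    rw [weight_eq, e]
    have : 0 < ‖ξ‖ ^ (2 - α) / |p.t| := by positivity
    linarith [mul_le_mul_of_nonneg_left h2 this.le]
  have h4 := inv_anti₀ (by positivity) h3
  rwa [mul_inv, inv_div] at h4

/-- The estimate for the integral that remains after `d` integrations by parts. -/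
theorem exists_lintegral_gain (hd : 1 ≤ d) (hφ : IsAlmostHomogeneousWith α B lam d₁ d₂ φ)
    (hα0 : α ≠ 0) (hα1 : α ≠ 1) (hB : 0 < B) (hlam : 0 < lam) (hd₁ : 0 < d₁) (hd₂ : 0 < d₂)
    (hc : 0 < c) :
    ∃ C : ℝ, 0 ≤ C ∧ ∀ p : PhaseParams d, ∫⁻ ξ in {ξ | ξ ≠ 0 ∧ c < p.size α ξ},
        ENNReal.ofReal (‖ξ‖ ^ (d * (α - 2) / 2) * p.gain α φ ξ ^ d) ≤
          ENNReal.ofReal (C * |p.t| ^ (-(d : ℝ) / 2)) := by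
  obtain ⟨C₁, hC₁, H₁⟩ := exists_lintegral_large_size (α := α) (c := c) hd hα0 hc
  obtain ⟨C₂, hC₂, H₂⟩ := exists_lintegral_resonantSet_weight_le hd hφ hα1 hB hlam hd₁ hd₂
  set K : ℝ := 2 ^ d * 2 ^ (d - 1) * (1 + (4 / d₁ ^ 2) ^ d) with hK
  have hK0 : 0 ≤ K := by positivity
  refine ⟨K * (C₁ + C₂), by positivity, fun p => ?_⟩
  set U : Set (EuclideanSpace ℝ (Fin d)) := {ξ | ξ ≠ 0 ∧ c < p.size α ξ} with hU
  have hUm : MeasurableSet U := (p.isOpen_lt_size α c).measurableSet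
  set Y : EuclideanSpace ℝ (Fin d) → ENNReal := fun ξ =>
    ENNReal.ofReal (‖ξ‖ ^ (d * (α - 2) / 2) * (p.size α ξ ^ d)⁻¹) with hY
  set W : EuclideanSpace ℝ (Fin d) → ENNReal := fun ξ =>
    ENNReal.ofReal (‖ξ‖ ^ (d * (α - 2) / 2) * (p.weight α φ ξ ^ d)⁻¹) with hW
  have hYm : Measurable Y := by
    simp only [hY, size]
    fun_prop
  have hpt : ∀ ξ ∈ U, ENNReal.ofReal (‖ξ‖ ^ (d * (α - 2) / 2) * p.gain α φ ξ ^ d) ≤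
      ENNReal.ofReal K * (Y ξ + (p.resonantSet φ α d₁).indicator W ξ) := fun ξ hξ => by
    have hξ' := norm_pos_iff.2 hξ.1
    have hw := p.weight_pos (α := α) (φ := φ) ξ
    have hs := p.size_pos (α := α) hξ.1
    set X := ‖ξ‖ ^ (d * (α - 2) / 2) with hX
    have hX0 : 0 ≤ X := by positivity
    have h1 : p.gain α φ ξ ^ d ≤ 2 ^ d * 2 ^ (d - 1) *
        ((p.weight α φ ξ ^ d)⁻¹ + (p.size α ξ ^ d)⁻¹) := by
      refine (pow_le_pow_left₀ (p.gain_nonneg ξ) (p.gain_le hξ.1) d).trans ?_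
      rw [mul_pow, mul_assoc, ← inv_pow, ← inv_pow]
      gcongr
      exact add_pow_le (by positivity) (by positivity) d
    have h2 : (1 : ℝ) ≤ 1 + (4 / d₁ ^ 2) ^ d := by
      have : 0 ≤ (4 / d₁ ^ 2) ^ d := by positivity
      linarith
    by_cases hr : ξ ∈ p.resonantSet φ α d₁
    · rw [Set.indicator_of_mem hr, hY, hW, ← ENNReal.ofReal_add (by positivity) (by positivity),
        ← ENNReal.ofReal_mul hK0]
      refine ENNReal.ofReal_le_ofReal ?_
      calc X * p.gain α φ ξ ^ d ≤ X * (2 ^ d * 2 ^ (d - 1) *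
            ((p.weight α φ ξ ^ d)⁻¹ + (p.size α ξ ^ d)⁻¹)) := by gcongr
        _ = 2 ^ d * 2 ^ (d - 1) * 1 *
            (X * (p.size α ξ ^ d)⁻¹ + X * (p.weight α φ ξ ^ d)⁻¹) := by ring
        _ ≤ _ := by
            rw [hK]
            gcongr
    · rw [Set.indicator_of_notMem hr, hY, add_zero, ← ENNReal.ofReal_mul hK0]
      refine ENNReal.ofReal_le_ofReal ?_
      have h3 := pow_le_pow_left₀ (by positivity)
        (p.weight_inv_le_of_notMem_resonantSet hd₁ hξ.1 hr) d
      rw [mul_pow, inv_pow, inv_pow] at h3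
      calc X * p.gain α φ ξ ^ d ≤ X * (2 ^ d * 2 ^ (d - 1) *
            ((p.weight α φ ξ ^ d)⁻¹ + (p.size α ξ ^ d)⁻¹)) := by gcongr
        _ ≤ X * (2 ^ d * 2 ^ (d - 1) *
            ((4 / d₁ ^ 2) ^ d * (p.size α ξ ^ d)⁻¹ + (p.size α ξ ^ d)⁻¹)) := by gcongr
        _ = _ := by
            rw [hK]
            ring
  calc _ ≤ ∫⁻ ξ in U, ENNReal.ofReal K * (Y ξ + (p.resonantSet φ α d₁).indicator W ξ) :=
        setLIntegral_mono' hUm hpt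
    _ = ENNReal.ofReal K *
        ((∫⁻ ξ in U, Y ξ) + ∫⁻ ξ in U, (p.resonantSet φ α d₁).indicator W ξ) := by
        rw [lintegral_const_mul' _ _ ENNReal.ofReal_ne_top, lintegral_add_left hYm]
    _ ≤ ENNReal.ofReal K * (ENNReal.ofReal (C₁ * |p.t| ^ (-(d : ℝ) / 2)) +
          ENNReal.ofReal (C₂ * |p.t| ^ (-(d : ℝ) / 2))) := by
        gcongr
        · exact H₁ p
        · exact (setLIntegral_le_lintegral _ _).trans ((lintegral_indicator_le _ _).trans (H₂ p))
    _ = _ := by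
        rw [← ENNReal.ofReal_add (by positivity) (by positivity), ← ENNReal.ofReal_mul hK0]
        congr 1
        ring

end PhaseParams

/-! ### Splitting the amplitude and the dispersive estimate -/

theorem IsCutoff.eq_zero {χ : ℝ → ℝ} (hχ : IsCutoff χ) {r : ℝ} (hr : 1 ≤ r) : χ r = 0 := by
  by_contra h
  exact absurd (hχ.tsupport_subset (subset_tsupport χ h)).2 (not_lt.2 hr)

theorem IsCutoff.isRadialProfile {χ : ℝ → ℝ} (hχ : IsCutoff χ) : IsRadialProfile χ :=
  ⟨hχ.smooth, 0, fun _ => hχ.eq_zero⟩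

theorem IsCutoff.isRadialProfile_one_sub {χ : ℝ → ℝ} (hχ : IsCutoff χ) :
    IsRadialProfile (fun r => 1 - χ r) :=
  ⟨contDiff_const.sub hχ.smooth, 1, fun r hr => by rw [hχ.eq_zero hr, sub_zero]⟩

theorem dampedIntegrand_add {d : ℕ} (φ a b : EuclideanSpace ℝ (Fin d) → ℝ) (κ : ℝ)
    (x : EuclideanSpace ℝ (Fin d)) (t : ℝ) :
    dampedIntegrand φ (fun ξ => a ξ + b ξ) κ x t =
      fun ξ => dampedIntegrand φ a κ x t ξ + dampedIntegrand φ b κ x t ξ := by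
  ext ξ
  simp only [dampedIntegrand]
  push_cast
  ring

theorem norm_dampedIntegrand {d : ℕ} (φ a : EuclideanSpace ℝ (Fin d) → ℝ) (κ : ℝ)
    (x : EuclideanSpace ℝ (Fin d)) (t : ℝ) (ξ : EuclideanSpace ℝ (Fin d)) :
    ‖dampedIntegrand φ a κ x t ξ‖ = |a ξ| *
      ‖((|(hessianMatrix φ ξ).det| : ℝ) : ℂ) ^ ((1 / 2 : ℂ) + Complex.I * (κ : ℂ))‖ := by
  rw [dampedIntegrand, norm_mul, norm_mul, mul_comm Complex.I, Complex.norm_exp_ofReal_mul_I,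
    one_mul, Complex.norm_real, Real.norm_eq_abs, mul_comm Complex.I]

namespace PhaseParams

open SymbolFrame

variable {d : ℕ} {α c B lam d₁ d₂ : ℝ} {φ : EuclideanSpace ℝ (Fin d) → ℝ} {χ : ℝ → ℝ}

theorem aestronglyMeasurable_dampedIntegrand (hd : 1 ≤ d)
    (hφ : IsAlmostHomogeneousWith α B lam d₁ d₂ φ) (hB : 0 ≤ B) (hlam : 0 < lam)
    {a : EuclideanSpace ℝ (Fin d) → ℝ} (ha : Continuous a) (κ : ℝ)
    (x : EuclideanSpace ℝ (Fin d)) (t : ℝ) :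
    AEStronglyMeasurable (dampedIntegrand φ a κ x t) volume := by
  have : Nonempty (Fin d) := ⟨⟨0, hd⟩⟩
  have h1 : ContinuousOn φ {0}ᶜ := hφ.contDiffOn.continuousOn
  have h2 := (hφ.isSymbol_damping (P := Unit) hB hlam (fun _ => κ)).continuousOn ()
  have h3 : ContinuousOn (dampedIntegrand φ a κ x t) {0}ᶜ := by
    refine ContinuousOn.mul (ContinuousOn.mul ?_ ?_) h2
    · refine Complex.continuous_exp.comp_continuousOn (continuousOn_const.mul
        (Complex.continuous_ofReal.comp_continuousOn (ContinuousOn.add ?_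
          (continuousOn_const.mul h1))))
      exact (continuous_const.inner continuous_id).continuousOn
    · exact (Complex.continuous_ofReal.comp ha).continuousOn
  have h4 := h3.aestronglyMeasurable (μ := volume) (measurableSet_singleton 0).compl
  rwa [restrict_compl_singleton] at h4

/-- The part of the integral in the region `s ≤ c`, where no oscillation is needed. -/
theorem exists_low_bound (hd : 1 ≤ d) (hφ : IsAlmostHomogeneousWith α B lam d₁ d₂ φ)
    (hα0 : α ≠ 0) (hB : 0 ≤ B) (hlam : 0 < lam) (hc : 0 < c) {b : ℝ} (hb : 0 ≤ b) :
    ∃ C, 0 ≤ C ∧ ∀ (p : PhaseParams d) (m : EuclideanSpace ℝ (Fin d) → ℝ), Continuous m →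
      (∀ ξ, |m ξ| ≤ b) → (∀ ξ, m ξ ≠ 0 → p.size α ξ ≤ c) →
      Integrable (dampedIntegrand φ m p.κ p.x p.t) ∧
        ‖∫ ξ, dampedIntegrand φ m p.κ p.x p.t ξ‖ ≤
          C * (1 + |p.κ|) ^ d * |p.t| ^ (-(d : ℝ) / 2) := by
  have : Nonempty (Fin d) := ⟨⟨0, hd⟩⟩
  obtain ⟨C₁, hC₁, H₁⟩ := exists_lintegral_small_size (α := α) hd hα0 hc
  obtain ⟨C₂, hC₂, H₂⟩ := (hφ.isSymbol_damping (P := PhaseParams d) hB hlam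
    (fun p => p.κ)).boundedBy
  refine ⟨b * C₂ * C₁, by positivity, fun p m hm hmb hms => ?_⟩
  set S : Set (EuclideanSpace ℝ (Fin d)) := {ξ | ξ ≠ 0 ∧ p.size α ξ ≤ c} with hS
  have hbound : ∫⁻ ξ, ENNReal.ofReal ‖dampedIntegrand φ m p.κ p.x p.t ξ‖ ≤
      ENNReal.ofReal (b * C₂ * C₁ * (1 + |p.κ|) ^ d * |p.t| ^ (-(d : ℝ) / 2)) := by
    calc _ ≤ ∫⁻ ξ, S.indicator (fun ξ => ENNReal.ofReal (b * C₂ * (1 + |p.κ|) ^ d) *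
          ENNReal.ofReal (‖ξ‖ ^ (d * (α - 2) / 2))) ξ := by
          refine lintegral_mono_ae ?_
          filter_upwards [Measure.ae_ne volume (0 : EuclideanSpace ℝ (Fin d))] with ξ hξ
          rw [norm_dampedIntegrand]
          by_cases h0 : m ξ = 0
          · simp [h0]
          · rw [Set.indicator_of_mem (show ξ ∈ S from ⟨hξ, hms ξ h0⟩),
              ← ENNReal.ofReal_mul (by positivity)]
            refine ENNReal.ofReal_le_ofReal ?_
            calc _ ≤ b * (C₂ * (‖ξ‖ ^ (d * (α - 2) / 2) * (1 + |p.κ|) ^ d)) :=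
                  mul_le_mul (hmb ξ) (H₂ p ξ hξ) (norm_nonneg _) hb
              _ = _ := by ring
      _ ≤ ∫⁻ ξ in S, ENNReal.ofReal (b * C₂ * (1 + |p.κ|) ^ d) *
          ENNReal.ofReal (‖ξ‖ ^ (d * (α - 2) / 2)) := lintegral_indicator_le _ _
      _ ≤ ENNReal.ofReal (b * C₂ * (1 + |p.κ|) ^ d) *
          ENNReal.ofReal (C₁ * |p.t| ^ (-(d : ℝ) / 2)) := by
          rw [lintegral_const_mul' _ _ ENNReal.ofReal_ne_top]
          gcongr
          exact H₁ p
      _ = _ := by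
          rw [← ENNReal.ofReal_mul (by positivity)]
          congr 1
          ring
  refine ⟨⟨aestronglyMeasurable_dampedIntegrand hd hφ hB hlam hm _ _ _, ?_⟩, ?_⟩
  · rw [hasFiniteIntegral_iff_norm]
    exact hbound.trans_lt ENNReal.ofReal_lt_top
  · exact (norm_integral_le_lintegral_norm _).trans
      (ENNReal.toReal_le_of_le_ofReal (by positivity) hbound)

/-- The amplitude `χ(A|ξ|) (1 - χ(B|ξ|))` of the oscillating part. -/
noncomputable def amplitude (χ : ℝ → ℝ) (p : PhaseParams d) (ξ : EuclideanSpace ℝ (Fin d)) : ℝ :=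
  χ (p.A * ‖ξ‖) * (1 - χ (p.B * ‖ξ‖))

/-- The oscillating part of the integral. The hypothesis on `p` says that the amplitude lives in
the region `s > c`. -/
theorem exists_high_bound (hd : 1 ≤ d) (hφ : IsAlmostHomogeneousWith α B lam d₁ d₂ φ)
    (hα0 : α ≠ 0) (hα1 : α ≠ 1) (hB : 0 < B) (hlam : 0 < lam) (hd₁ : 0 < d₁) (hd₂ : 0 < d₂)
    (hc : 0 < c) (hχ : IsCutoff χ) :
    ∃ C, 0 ≤ C ∧ ∀ p : PhaseParams d,
      (∀ ξ, ξ ≠ 0 → 1 / 2 ≤ p.B * ‖ξ‖ → p.A * ‖ξ‖ ≤ 1 → c < p.size α ξ) →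
      Integrable (dampedIntegrand φ (p.amplitude χ) p.κ p.x p.t) ∧
        ‖∫ ξ, dampedIntegrand φ (p.amplitude χ) p.κ p.x p.t ξ‖ ≤
          C * (1 + |p.κ|) ^ d * |p.t| ^ (-(d : ℝ) / 2) := by
  obtain ⟨C₁, hC₁, H₁⟩ := exists_lintegral_gain hd hφ hα0 hα1 hB hlam hd₁ hd₂ hc
  set f : PhaseParams d → EuclideanSpace ℝ (Fin d) → ℂ := fun p ξ =>
    ((χ (p.A * ‖ξ‖) : ℝ) : ℂ) * ((1 - χ (p.B * ‖ξ‖) : ℝ) : ℂ) *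
      ((|(hessianMatrix φ ξ).det| : ℝ) : ℂ) ^ ((1 / 2 : ℂ) + Complex.I * (p.κ : ℂ)) with hf
  have hsym : (oscFrame α c φ).IsSymbol d
      (fun p ξ => ‖ξ‖ ^ (d * (α - 2) / 2) * (1 + |p.κ|) ^ d) f := by
    have h1 := isSymbol_radial (d := d) (k := d) hχ.isRadialProfile
      (fun p : PhaseParams d => p.A) fun p => p.A_pos
    have h2 := isSymbol_radial (d := d) (k := d) hχ.isRadialProfile_one_sub
      (fun p : PhaseParams d => p.B) fun p => p.B_pos
    have h3 := hφ.isSymbol_damping (P := PhaseParams d) hB.le hlam fun p => p.κ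
    refine (isSymbol_of_punctured ((h1.mul h2).mul h3) fun p ξ _ => by positivity).weight_congr
      fun p ξ _ => ?_
    rw [one_mul, one_mul]
  obtain ⟨C₂, hC₂, H₂⟩ := exists_integral_eq_of_isSymbol hφ hB.le le_rfl
    (fun p ξ => by positivity) hsym
  refine ⟨C₂ * C₁, by positivity, fun p hp => ?_⟩
  set K : Set (EuclideanSpace ℝ (Fin d)) := {ξ | 1 / 2 ≤ p.B * ‖ξ‖ ∧ p.A * ‖ξ‖ ≤ 1} with hK
  have hKc : IsCompact K := by
    refine (isCompact_closedBall (0 : EuclideanSpace ℝ (Fin d)) p.A⁻¹).of_isClosed_subset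
      ((isClosed_le continuous_const (continuous_const.mul continuous_norm)).inter
        (isClosed_le (continuous_const.mul continuous_norm) continuous_const)) fun η hη => ?_
    have := hη.2
    rw [mem_closedBall_zero_iff, ← one_div, le_div_iff₀ p.A_pos, mul_comm]
    exact this
  have hKU : K ⊆ (oscFrame α c φ).U p := fun ξ hξ => by
    have h0 : ξ ≠ 0 := fun h0 => by
      have := hξ.1
      rw [h0, norm_zero, mul_zero] at this
      norm_num at this
    exact ⟨h0, hp ξ h0 hξ.1 hξ.2⟩
  have h0 : ∀ ξ ∉ K, f p ξ = 0 := fun ξ hξ => by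
    simp only [hf]
    by_cases h1 : p.A * ‖ξ‖ ≤ 1
    · have h2 : p.B * ‖ξ‖ < 1 / 2 := by
        by_contra h
        exact hξ ⟨not_lt.1 h, h1⟩
      have h3 : 0 ≤ p.B * ‖ξ‖ := mul_nonneg p.B_pos.le (norm_nonneg _)
      rw [hχ.eq_one (p.B * ‖ξ‖) ⟨by linarith, h2⟩]
      simp
    · rw [hχ.eq_zero (not_le.1 h1).le]
      simp
  have heq : dampedIntegrand φ (p.amplitude χ) p.κ p.x p.t = fun ξ => p.phaseExp φ ξ * f p ξ := by
    ext ξ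
    simp only [dampedIntegrand, amplitude, phaseExp, hf]
    push_cast
    ring
  have he : ContinuousOn (p.phaseExp φ) ((oscFrame α c φ).U p) := fun ξ hξ =>
    (differentiableAt_and_fderiv_phaseExp hφ p hξ.1).1.continuousAt.continuousWithinAt
  refine ⟨?_, ?_⟩
  · rw [heq]
    exact integrable_of_continuousOn hKc hKU (he.mul (hsym.continuousOn p)) fun ξ hξ => by
      rw [h0 ξ hξ, mul_zero]
  obtain ⟨g, hg0, hg, hgi⟩ := H₂ p K hKc hKU h0
  rw [heq, hgi]
  refine (norm_integral_le_lintegral_norm _).trans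
    (ENNReal.toReal_le_of_le_ofReal (by positivity) ?_)
  calc _ ≤ ∫⁻ ξ, ({ξ | ξ ≠ 0 ∧ c < p.size α ξ} : Set (EuclideanSpace ℝ (Fin d))).indicator
        (fun ξ => ENNReal.ofReal (C₂ * (1 + |p.κ|) ^ d) *
          ENNReal.ofReal (‖ξ‖ ^ (d * (α - 2) / 2) * p.gain α φ ξ ^ d)) ξ := by
        refine lintegral_mono fun ξ => ?_
        by_cases hξ : ξ ∈ K
        · rw [Set.indicator_of_mem (show ξ ∈ {ξ | ξ ≠ 0 ∧ c < p.size α ξ} from hKU hξ),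
            ← ENNReal.ofReal_mul (by positivity), norm_mul,
            phaseExp, mul_comm Complex.I, Complex.norm_exp_ofReal_mul_I, one_mul]
          exact ENNReal.ofReal_le_ofReal ((hg ξ hξ).trans_eq (by ring))
        · simp [hg0 ξ hξ]
    _ ≤ ∫⁻ ξ in {ξ | ξ ≠ 0 ∧ c < p.size α ξ}, ENNReal.ofReal (C₂ * (1 + |p.κ|) ^ d) *
          ENNReal.ofReal (‖ξ‖ ^ (d * (α - 2) / 2) * p.gain α φ ξ ^ d) :=
        lintegral_indicator_le _ _
    _ ≤ ENNReal.ofReal (C₂ * (1 + |p.κ|) ^ d) *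
          ENNReal.ofReal (C₁ * |p.t| ^ (-(d : ℝ) / 2)) := by
        rw [lintegral_const_mul' _ _ ENNReal.ofReal_ne_top]
        gcongr
        exact H₁ p
    _ = _ := by
        rw [← ENNReal.ofReal_mul (by positivity)]
        congr 1
        ring

/-- The estimate for a continuous cutoff `a` that differs from the oscillating amplitude by a
bounded function living in the region `s ≤ c₀`. -/
theorem exists_bound (hd : 1 ≤ d) (hφ : IsAlmostHomogeneousWith α B lam d₁ d₂ φ)
    (hα0 : α ≠ 0) (hα1 : α ≠ 1) (hB : 0 < B) (hlam : 0 < lam) (hd₁ : 0 < d₁) (hd₂ : 0 < d₂)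
    {c₀ : ℝ} (hc : 0 < c) (hc₀ : 0 < c₀) {b : ℝ} (hb : 0 ≤ b) (hχ : IsCutoff χ) :
    ∃ C, ∀ (p : PhaseParams d) (a : EuclideanSpace ℝ (Fin d) → ℝ), Continuous a →
      (∀ ξ, ξ ≠ 0 → 1 / 2 ≤ p.B * ‖ξ‖ → p.A * ‖ξ‖ ≤ 1 → c < p.size α ξ) →
      (∀ ξ, |a ξ - p.amplitude χ ξ| ≤ b) →
      (∀ ξ, a ξ - p.amplitude χ ξ ≠ 0 → p.size α ξ ≤ c₀) →
      Integrable (dampedIntegrand φ a p.κ p.x p.t) ∧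
        ‖∫ ξ, dampedIntegrand φ a p.κ p.x p.t ξ‖ ≤
          C * (1 + |p.κ|) ^ (d : ℝ) * |p.t| ^ (-(d : ℝ) / 2) := by
  obtain ⟨C₁, -, H₁⟩ := exists_high_bound hd hφ hα0 hα1 hB hlam hd₁ hd₂ hc hχ
  obtain ⟨C₂, -, H₂⟩ := exists_low_bound hd hφ hα0 hB.le hlam hc₀ hb
  refine ⟨C₁ + C₂, fun p a ha hp hab has => ?_⟩
  have hχc : Continuous χ := hχ.smooth.continuous
  have hamp : Continuous (p.amplitude χ) := by
    unfold amplitude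
    fun_prop
  obtain ⟨i₁, h₁⟩ := H₁ p hp
  obtain ⟨i₂, h₂⟩ := H₂ p (fun ξ => a ξ - p.amplitude χ ξ) (ha.sub hamp) hab has
  have heq : dampedIntegrand φ a p.κ p.x p.t = fun ξ =>
      dampedIntegrand φ (p.amplitude χ) p.κ p.x p.t ξ +
        dampedIntegrand φ (fun ξ => a ξ - p.amplitude χ ξ) p.κ p.x p.t ξ := by
    rw [← dampedIntegrand_add]
    congr 1
    ext ξ
    ring
  rw [heq]
  refine ⟨i₁.add i₂, ?_⟩
  rw [integral_add i₁ i₂, Real.rpow_natCast]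
  refine (norm_add_le _ _).trans ((add_le_add h₁ h₂).trans_eq ?_)
  ring

end PhaseParams

/-- The absolute value of the integrand does not depend on `t`, so integrability at one nonzero
time gives integrability at `t = 0`. -/
theorem IsAlmostHomogeneousWith.integrable_dampedIntegrand_of_one {d : ℕ} (hd : 1 ≤ d)
    {α B lam d₁ d₂ : ℝ} {φ : EuclideanSpace ℝ (Fin d) → ℝ}
    (hφ : IsAlmostHomogeneousWith α B lam d₁ d₂ φ) (hB : 0 ≤ B) (hlam : 0 < lam)
    {a : EuclideanSpace ℝ (Fin d) → ℝ} (ha : Continuous a) {κ : ℝ}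
    {x : EuclideanSpace ℝ (Fin d)} (h : Integrable (dampedIntegrand φ a κ x 1)) (t : ℝ) :
    Integrable (dampedIntegrand φ a κ x t) :=
  h.mono (PhaseParams.aestronglyMeasurable_dampedIntegrand hd hφ hB hlam ha κ x t)
    (Filter.Eventually.of_forall fun ξ => by simp only [norm_dampedIntegrand, le_refl])

theorem proposition3p7 (d : ℕ) (hd : 1 ≤ d) (χ : ℝ → ℝ) (hχ : IsCutoff χ)
    (α : ℝ) (hα0 : α ≠ 0) (hα1 : α ≠ 1)
    (φ : EuclideanSpace ℝ (Fin d) → ℝ) (hφ : IsAlmostHomogeneous α φ) :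
    ∃ C N : ℝ, 0 < N ∧
      ∀ (ε : ℝ), 0 < ε → ∀ (κ : ℝ) (x : EuclideanSpace ℝ (Fin d)) (t : ℝ),
        (0 < α →
          Integrable (dampedIntegrand φ (cutoffPlus χ ε) κ x t) volume ∧
          (t ≠ 0 → ‖oscIntegralPlus χ φ ε κ x t‖ ≤
            C * (1 + |κ|) ^ N * |t| ^ (-(d : ℝ) / 2))) ∧
        (α < 0 →
          Integrable (dampedIntegrand φ (cutoffMinus χ ε) κ x t) volume ∧
          (t ≠ 0 → ‖oscIntegralMinus χ φ ε κ x t‖ ≤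
            C * (1 + |κ|) ^ N * |t| ^ (-(d : ℝ) / 2))) := by
  obtain ⟨B, lam, d₁, d₂, hB, hlam, hd₁, hd₂, hφ⟩ := hφ
  obtain ⟨b, hb, hχb⟩ := hχ.isRadialProfile.bounded
  have hχc : Continuous χ := hχ.smooth.continuous
  -- With `ρ = |t|^{1/α}` one has `s = (ρ|ξ|)^α`. The bounds `1 / 2 ≤ ρ|ξ|` or `ρ|ξ| ≤ 1` that
  -- come from the supports give `s ≥ 2 ^ (-|α|)` on the oscillating part and `s ≤ 2 ^ |α|` on the
  -- rest.
  obtain ⟨C, H⟩ := PhaseParams.exists_bound (c := 2 ^ (-|α|) / 2) (c₀ := 2 ^ |α|)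
    (b := (1 + b) ^ 2) hd hφ hα0 hα1 hB hlam hd₁ hd₂ (by positivity) (by positivity)
    (by positivity) hχ
  have hchi : ∀ r : ℝ, 0 < r → ∀ ξ : EuclideanSpace ℝ (Fin d),
      |χ (r * ‖ξ‖)| ≤ 1 + b ∧ |1 - χ (r * ‖ξ‖)| ≤ 1 + b := fun r hr ξ => by
    have h1 := hχb (r * ‖ξ‖) (by positivity)
    refine ⟨by linarith, (abs_sub _ _).trans ?_⟩
    rw [abs_one]
    linarith
  have hpow : (2 : ℝ) ^ (-|α|) / 2 < 2 ^ (-|α|) := half_lt_self (by positivity)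
  have hpow1 : (2 : ℝ) ^ (-|α|) ≤ 1 :=
    Real.rpow_le_one_of_one_le_of_nonpos one_le_two (by simp)
  have hpow2 : (1 : ℝ) ≤ 2 ^ |α| := Real.one_le_rpow one_le_two (abs_nonneg _)
  have hplus : 0 < α → ∀ ε : ℝ, 0 < ε → ∀ κ x t, t ≠ 0 →
      Integrable (dampedIntegrand φ (cutoffPlus χ ε) κ x t) volume ∧
        ‖oscIntegralPlus χ φ ε κ x t‖ ≤ C * (1 + |κ|) ^ (d : ℝ) * |t| ^ (-(d : ℝ) / 2) := by
    intro hα ε hε κ x t ht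
    have hρ : 0 < |t| ^ α⁻¹ := Real.rpow_pos_of_pos (abs_pos.2 ht) _
    let p : PhaseParams d := ⟨ε, |t| ^ α⁻¹, κ, t, x, hε, hρ, ht⟩
    have hdiff : ∀ ξ, cutoffPlus χ ε ξ - p.amplitude χ ξ =
        χ (ε * ‖ξ‖) * χ (|t| ^ α⁻¹ * ‖ξ‖) := fun ξ => by
      simp only [cutoffPlus, PhaseParams.amplitude, p]
      ring
    refine H p (cutoffPlus χ ε) (by unfold cutoffPlus; fun_prop) (fun ξ hξ h1 _ => ?_)
      (fun ξ => ?_) fun ξ hξ => ?_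
    · rw [p.size_eq_rpow hα0]
      refine hpow.trans_le ?_
      have := Real.rpow_le_rpow (by norm_num) h1 hα.le
      rw [abs_of_pos hα]
      refine le_trans (le_of_eq ?_) this
      rw [Real.div_rpow zero_le_one zero_le_two, Real.one_rpow, Real.rpow_neg zero_le_two, one_div]
    · rw [hdiff, abs_mul, sq]
      exact mul_le_mul (hchi _ hε ξ).1 (hchi _ hρ ξ).1 (abs_nonneg _) (by positivity)
    · rw [hdiff] at hξ
      rw [p.size_eq_rpow hα0]
      have h1 : |t| ^ α⁻¹ * ‖ξ‖ ≤ 1 := by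
        by_contra h
        exact hξ (by rw [hχ.eq_zero (not_le.1 h).le, mul_zero])
      exact (Real.rpow_le_one (by positivity) h1 hα.le).trans hpow2
  have hminus : α < 0 → ∀ ε : ℝ, 0 < ε → ∀ κ x t, t ≠ 0 →
      Integrable (dampedIntegrand φ (cutoffMinus χ ε) κ x t) volume ∧
        ‖oscIntegralMinus χ φ ε κ x t‖ ≤ C * (1 + |κ|) ^ (d : ℝ) * |t| ^ (-(d : ℝ) / 2) := by
    intro hα ε hε κ x t ht
    have hρ : 0 < |t| ^ α⁻¹ := Real.rpow_pos_of_pos (abs_pos.2 ht) _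
    have hε' : 0 < ε⁻¹ := inv_pos.2 hε
    let p : PhaseParams d := ⟨|t| ^ α⁻¹, ε⁻¹, κ, t, x, hρ, hε', ht⟩
    have hdiff : ∀ ξ, cutoffMinus χ ε ξ - p.amplitude χ ξ =
        (1 - χ (ε⁻¹ * ‖ξ‖)) * (1 - χ (|t| ^ α⁻¹ * ‖ξ‖)) := fun ξ => by
      simp only [cutoffMinus, PhaseParams.amplitude, p]
      ring
    refine H p (cutoffMinus χ ε) (by unfold cutoffMinus; fun_prop) (fun ξ hξ _ h1 => ?_)
      (fun ξ => ?_) fun ξ hξ => ?_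
    · rw [p.size_eq_rpow hα0]
      have h2 : 0 < |t| ^ α⁻¹ * ‖ξ‖ := mul_pos hρ (norm_pos_iff.2 hξ)
      exact (hpow.trans_le hpow1).trans_le (Real.one_le_rpow_of_pos_of_le_one_of_nonpos h2 h1 hα.le)
    · rw [hdiff, abs_mul, sq]
      exact mul_le_mul (hchi _ hε' ξ).2 (hchi _ hρ ξ).2 (abs_nonneg _) (by positivity)
    · rw [hdiff] at hξ
      rw [p.size_eq_rpow hα0]
      have h1 : 1 / 2 ≤ |t| ^ α⁻¹ * ‖ξ‖ := by
        by_contra h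
        have h3 : 0 ≤ |t| ^ α⁻¹ * ‖ξ‖ := by positivity
        exact hξ (by rw [hχ.eq_one (|t| ^ α⁻¹ * ‖ξ‖) ⟨by linarith, not_le.1 h⟩]; simp)
      have := Real.rpow_le_rpow_of_nonpos (by norm_num) h1 hα.le
      refine this.trans_eq ?_
      rw [abs_of_neg hα, Real.div_rpow zero_le_one zero_le_two, Real.one_rpow,
        Real.rpow_neg zero_le_two, one_div]
  refine ⟨C, d, by exact_mod_cast hd, fun ε hε κ x t => ⟨fun hα => ⟨?_, fun ht =>
    (hplus hα ε hε κ x t ht).2⟩, fun hα => ⟨?_, fun ht => (hminus hα ε hε κ x t ht).2⟩⟩⟩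
  · exact hφ.integrable_dampedIntegrand_of_one hd hB.le hlam (by unfold cutoffPlus; fun_prop)
      (hplus hα ε hε κ x 1 one_ne_zero).1 t
  · exact hφ.integrable_dampedIntegrand_of_one hd hB.le hlam (by unfold cutoffMinus; fun_prop)
      (hminus hα ε hε κ x 1 one_ne_zero).1 t
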